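/- All Banach spaces are over $\mathbb R$, and $Y^*$ denotes the dual of $Y$ with closed unit ball $B_{Y^*}$. Let $\beta\omega$ be the Čech–Stone compactification of the discrete space $\omega$ and $\omega^*=\beta\omega\setminus\omega$ its remainder. A countable discrete extension of a compact Hausdorff space $K$ is a compact Hausdorff space $L\supseteq K$, containing $K$ as a subspace, such that $L\setminus K$ is a countably infinite discrete set. If $K$ is also a subspace of a topological space $Z$, then $L$ can be realized inside $Z$ if the inclusion map $K\to Z$ extends to a homeomorphic embedding $L\to Z$. **Theorem.** For an infinite-dimensional Banach space $Y$ the following are equivalent: (i) $\mathrm{Ext}(Y,c_0)=0$, i.e. for every short exact sequence $0\to c_0\xrightarrow{\,i\,}X\to Y\to 0$ of Banach spaces and bounded linear operators, $i$ has a bounded linear left inverse $X\to c_0$; (ii) every countable discrete extension of $(B_{Y^*},\mathrm{weak}^*)$ can be realized inside $(Y^*,\mathrm{weak}^*)$; (iii) every countable discrete extension of any compact subset of $(Y^*,\mathrm{weak}^*)$ can be realized inside $(Y^*,\mathrm{weak}^*)$; (iv) every continuous function $\omega^*\to(Y^*,\mathrm{weak}^*)$ extends to a continuous function $\beta\omega\to(Y^*,\mathrm{weak}^*)$;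 (v) every bounded linear operator $T:Y\to\ell_\infty/c_0$ can be lifted to $\ell_\infty$, i.e. there is a bounded linear operator $\widetilde T:Y\to\ell_\infty$ with $Q\widetilde T=T$, where $Q:\ell_\infty\to\ell_\infty/c_0$ is the quotient map. -/

import Mathlib

open Set Filter Topology

universe u v

/-- The real Banach space of bounded real sequences with the supremum norm. -/
abbrev EllInfty : Type := lp (fun _ : ℕ => ℝ) ⊤

/-- The space of real null sequences, as a subspace of `EllInfty` (with the supremum norm). -/
def czero : Submodule ℝ EllInfty where
  carrier := {x | Tendsto (fun n => x n) atTop (𝓝 (0 : ℝ))}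
  add_mem' := by
    intro a b ha hb
    have h : Tendsto (fun n => a n + b n) atTop (𝓝 (0 + 0 : ℝ)) := Tendsto.add ha hb
    rw [add_zero] at h
    exact h
  zero_mem' := by
    change Tendsto (fun _ : ℕ => (0 : ℝ)) atTop (𝓝 0)
    exact tendsto_const_nhds
  smul_mem' := by
    intro c x hx
    have h : Tendsto (fun n => c * x n) atTop (𝓝 (c * 0 : ℝ)) := Tendsto.const_mul c hx
    rw [mul_zero] at h
    exact h

/-- `ExtEqZero Y Z` says that `Ext(Y, Z) = 0`: every short exact sequence `0 → Z → X → Y → 0` of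
Banach spaces and bounded operators splits, i.e. `Z → X` has a bounded left inverse.
The middle term is equipotent with `Z × Y`, so the universe of `X` is no restriction. -/
def ExtEqZero (Y : Type u) [NormedAddCommGroup Y] [NormedSpace ℝ Y]
    (Z : Type v) [NormedAddCommGroup Z] [NormedSpace ℝ Z] : Prop :=
  ∀ (X : Type (max u v)) [NormedAddCommGroup X] [NormedSpace ℝ X] [CompleteSpace X]
    (i : Z →L[ℝ] X) (p : X →L[ℝ] Y),
    Function.Injective i → Function.Exact i p → Function.Surjective p →
      ∃ r : X →L[ℝ] Z, ∀ z : Z, r (i z) = z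

/-- `j : K → L` presents `L` as a countable discrete extension of `K`: `L` is a compact Hausdorff
space, `j` is a homeomorphic embedding, and the subspace `L \ j(K)` is countably infinite and
discrete. -/
structure IsCountableDiscreteExtension {K : Type u} {L : Type v} [TopologicalSpace K]
    [TopologicalSpace L] (j : K → L) : Prop where
  compactSpace : CompactSpace L
  t2Space : T2Space L
  isEmbedding : IsEmbedding j
  countable_compl : (range j)ᶜ.Countable
  infinite_compl : (range j)ᶜ.Infinite
  discrete_compl : DiscreteTopology ↥(range j)ᶜ

/-- Every countable discrete extension `L` of the subspace `K` of `Z` can be realized inside `Z`: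
the inclusion `K → Z` extends to a homeomorphic embedding `L → Z`. Such an `L` is equipotent with
the disjoint union of `K` and `ℕ`, so the universe of `L` is no restriction. -/
def DiscreteExtensionsRealizable {Z : Type u} [TopologicalSpace Z] (K : Set Z) : Prop :=
  ∀ (L : Type u) [TopologicalSpace L] (j : K → L), IsCountableDiscreteExtension j →
    ∃ φ : L → Z, IsEmbedding φ ∧ ∀ x : K, φ (j x) = x

/-- The Stone–Čech compactification of the discrete space `ℕ`, with its standard model as the space
of ultrafilters. -/
abbrev BetaOmega : Type := Ultrafilter ℕ

/-- The remainder of the Stone–Čech compactification of `ℕ`: the nonprincipal ultrafilters. -/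
def omegaStar : Set BetaOmega := (range (pure : ℕ → Ultrafilter ℕ))ᶜ

/-- The dual unit ball, as a subset of the dual with the weak* topology. -/
def dualBall (Y : Type u) [NormedAddCommGroup Y] [NormedSpace ℝ Y] : Set (WeakDual ℝ Y) :=
  WeakDual.toStrongDual ⁻¹' Metric.closedBall 0 1

/-! Everything rests on the identification of $\ell_\infty/c_0$ with $C(\omega^*)$. A bounded
operator $Y\to\ell_\infty$ is a bounded sequence of functionals, hence a weak* continuous map
$\beta\omega\to Y^*$; an operator $T:Y\to\ell_\infty/c_0$ is a weak* continuous map $\omega^*\to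
Y^*$, taking $U$ to the limit along $U$ of representatives of $Ty$. Lifting operators is thus
extending maps from $\omega^*$ to $\beta\omega$. Splitting of extensions by $c_0$ is equivalent to
lifting, by Hahn–Banach on coordinates in one direction and a pullback in the other.

An operator $T$ of norm at most one also attaches a sequence of isolated points to the dual ball,
with limits prescribed by $T$; a realization of this compactum in $Y^*$ is a bounded sequence of
functionals lifting $T$. Conversely, the isolated points of an extension $L$ of $K$ induce a map
$\omega^*\to K$. Extending it to $\beta\omega$ gives functionals with the right limits, though
possibly repeated or inside $K$. Adding large multiples of a normalized weak* null sequence repairs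
both defects without changing limits.

Such a null sequence exists by the Josefson–Nissenzweig theorem. A bounded separated sequence in
$Y^*$ either has a weak* convergent subsequence, whose differences suffice, or contains a triangular
system. There one passes to convex blocks whose pointwise oscillation no further blocking can
reduce. Oscillation zero yields null differences; positive oscillation yields a dyadic tree, and
Rademacher averages over its leaves are null by Bessel's inequality. -/

/-! ### Limits and separation of bounded sequences of functionals -/

section JosefsonNissenzweig

open scoped ENNReal

variable {Y : Type u} [NormedAddCommGroup Y] [NormedSpace ℝ Y]

/-- Bounded families of functionals have pointwise limits along ultrafilters. -/
theorem exists_pointwise_limit_ultrafilter {ι : Type*} (U : Ultrafilter ι)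
    {g : ι → StrongDual ℝ Y} {C : ℝ} (hg : ∀ i, ‖g i‖ ≤ C) :
    ∃ φ : StrongDual ℝ Y, ‖φ‖ ≤ C ∧ ∀ y, Tendsto (fun i => g i y) U (𝓝 (φ y)) := by
  have hK := WeakDual.isCompact_closedBall (𝕜 := ℝ) (0 : StrongDual ℝ Y) C
  obtain ⟨φ, hφ, hlim⟩ := hK.ultrafilter_le_nhds
    (U.map fun i => StrongDual.toWeakDual (g i)) (by
      rw [le_principal_iff, Ultrafilter.mem_coe, Ultrafilter.mem_map]
      refine univ_mem' fun i => ?_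
      simpa using hg i)
  refine ⟨WeakDual.toStrongDual φ, by simpa using hφ, fun y => ?_⟩
  exact ((WeakDual.eval_continuous y).tendsto φ).comp hlim

theorem ContinuousLinearMap.exists_norm_le_one_half_norm_le (z : StrongDual ℝ Y) :
    ∃ y : Y, ‖y‖ ≤ 1 ∧ ‖z‖ ≤ 2 * |z y| := by
  rcases eq_or_ne z 0 with rfl | hz
  · exact ⟨0, by simp, by simp⟩
  · have hz' : 0 < ‖z‖ := norm_pos_iff.2 hz
    obtain ⟨y, hy, hlt⟩ := z.exists_lt_apply_of_lt_opNorm (half_lt_self hz')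
    refine ⟨y, hy.le, ?_⟩
    rw [Real.norm_eq_abs] at hlt
    linarith

/-- The closed span of a sequence of functionals is separated by countably many points. -/
theorem exists_seq_separating_closure_span (g : ℕ → StrongDual ℝ Y) :
    ∃ e : ℕ → Y, ∀ z ∈ closure (Submodule.span ℝ (range g) : Set (StrongDual ℝ Y)),
      (∀ n, z (e n) = 0) → z = 0 := by
  obtain ⟨c, hc, hsub⟩ :=
    ((TopologicalSpace.IsSeparable.span (R := ℝ) (countable_range g).isSeparable)).closure
  have hne : c.Nonempty := by
    by_contra h
    rw [not_nonempty_iff_eq_empty] at h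
    subst h
    simpa using hsub (subset_closure (Submodule.zero_mem (Submodule.span ℝ (range g))))
  obtain ⟨w, rfl⟩ := hc.exists_eq_range hne
  -- Each `e n` norms the dense element `w n` up to a factor 2. If `z` vanishes at all `e n`, then
  -- `‖w n‖ ≤ 2 * ‖z - w n‖`, so `‖z‖ ≤ 3 * ‖z - w n‖`, whence the tolerance `δ / 3`.
  choose e he1 he2 using fun n => (w n).exists_norm_le_one_half_norm_le
  refine ⟨e, fun z hz h0 => ?_⟩
  rw [← norm_le_zero_iff]
  refine le_of_forall_pos_le_add fun δ hδ => ?_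
  obtain ⟨_, ⟨n, rfl⟩, hn⟩ := Metric.mem_closure_iff.1 (hsub hz) (δ / 3) (by positivity)
  rw [dist_eq_norm] at hn
  have h1 : |w n (e n)| ≤ ‖z - w n‖ := by
    have := (z - w n).le_opNorm (e n)
    rw [sub_apply, h0 n, zero_sub, norm_neg, Real.norm_eq_abs] at this
    exact this.trans (mul_le_of_le_one_right (norm_nonneg _) (he1 n))
  have h2 : ‖z‖ ≤ ‖z - w n‖ + ‖w n‖ := norm_le_norm_sub_add z (w n)
  linarith [he2 n]

/-- Helly's lemma: a functional at distance `d` from the span of finitely many others is larger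
than `d / 2` at some point of the unit ball where the others vanish. -/
theorem exists_apply_eq_zero_half_lt_apply {ι : Type*} [Finite ι] (F : ι → StrongDual ℝ Y)
    (φ : StrongDual ℝ Y) {d : ℝ} (hd : 0 < d)
    (h : ∀ z ∈ Submodule.span ℝ (range F), d ≤ ‖φ - z‖) :
    ∃ y : Y, ‖y‖ ≤ 1 ∧ (∀ i, F i y = 0) ∧ d / 2 < φ y := by
  have := Fintype.ofFinite ι
  let W : Submodule ℝ Y := ⨅ i, LinearMap.ker (F i).toLinearMap
  -- With `ψ` a Hahn–Banach extension of `φ` restricted to `W`, the difference `φ - ψ` vanishes on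
  -- `W`, so it lies in the span of the `F i`. Hence `‖ψ‖ = ‖φ - (φ - ψ)‖ ≥ d`.
  obtain ⟨ψ, hψ, hnorm⟩ := exists_extension_norm_eq W (φ.comp W.subtypeL)
  have hmem : (φ - ψ).toLinearMap ∈ Submodule.span ℝ (range fun i => (F i).toLinearMap) := by
    refine mem_span_of_iInf_ker_le_ker fun y hy => ?_
    have := hψ ⟨y, hy⟩
    simp at this
    simp [this]
  obtain ⟨c, hc⟩ := (Submodule.mem_span_range_iff_exists_fun ℝ).1 hmem
  have hc' : ∑ i, c i • F i = φ - ψ := by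
    ext y
    have := LinearMap.congr_fun hc y
    simpa using this
  have hle : d ≤ ‖φ.comp W.subtypeL‖ := by
    rw [← hnorm]
    have := h (φ - ψ) (hc' ▸ (Submodule.mem_span_range_iff_exists_fun ℝ).2 ⟨c, rfl⟩)
    simpa using this
  obtain ⟨w, hw, hlt⟩ := (φ.comp W.subtypeL).exists_lt_apply_of_lt_opNorm
    (show d / 2 < _ by linarith)
  have hker : ∀ i, F i (w : Y) = 0 := fun i => by
    have := (Submodule.mem_iInf _).1 w.2 i
    simpa using this
  have hlt' : d / 2 < |φ (w : Y)| := by simpa using hlt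
  rcases lt_abs.1 hlt' with h' | h'
  · exact ⟨w, hw.le, hker, h'⟩
  · exact ⟨-w, by simpa using hw.le, fun i => by simp [hker i], by simpa using h'⟩

/-- A bounded sequence of functionals has a pointwise convergent subsequence or a subsequence
whose initial segments and tails are uniformly separated by points of the unit ball. -/
theorem exists_subseq_tendsto_or_separated {g : ℕ → StrongDual ℝ Y} {C : ℝ}
    (hg : ∀ n, ‖g n‖ ≤ C) :
    (∃ σ : ℕ → ℕ, StrictMono σ ∧ ∃ φ : StrongDual ℝ Y,
      ∀ y, Tendsto (fun n => g (σ n) y) atTop (𝓝 (φ y))) ∨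
    ∃ (σ : ℕ → ℕ) (y : ℕ → Y) (d : ℝ), 0 < d ∧ (∀ i, ‖y i‖ ≤ 1) ∧
      (∀ i j, i ≤ j → d ≤ g (σ j) (y i)) ∧ ∀ i j, j < i → g (σ j) (y i) = 0 := by
  obtain ⟨e, he⟩ := exists_seq_separating_closure_span g
  set Z := closure (Submodule.span ℝ (range g) : Set (StrongDual ℝ Y)) with hZ
  have hcomp : IsCompact (univ.pi fun n : ℕ => Icc (-(C * ‖e n‖)) (C * ‖e n‖)) :=
    isCompact_univ_pi fun n => isCompact_Icc
  obtain ⟨a, -, σ, hσ, ha⟩ := hcomp.tendsto_subseq (x := fun k n => g k (e n)) (fun k n _ => by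
    have := (g k).le_of_opNorm_le (hg k) (e n)
    rw [Real.norm_eq_abs, abs_le] at this
    exact this)
  have ha' : ∀ n, Tendsto (fun k => g (σ k) (e n)) atTop (𝓝 (a n)) := fun n =>
    (tendsto_pi_nhds.1 ha) n
  -- If all cluster functionals lie in `Z`, any two of them agree on the separating points `e n`, so
  -- they coincide and the subsequence converges. Otherwise some cluster functional has positive
  -- distance from the span.
  by_cases hall : ∀ (U : Ultrafilter ℕ) (φ : StrongDual ℝ Y), (U : Filter ℕ) ≤ atTop →
      (∀ y, Tendsto (fun k => g (σ k) y) U (𝓝 (φ y))) → φ ∈ Z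
  · left
    obtain ⟨φ, -, hφ⟩ := exists_pointwise_limit_ultrafilter (hyperfilter ℕ)
      (fun k => hg (σ k))
    have hyp : (hyperfilter ℕ : Filter ℕ) ≤ atTop := by
      rw [← Nat.cofinite_eq_atTop]; exact hyperfilter_le_cofinite
    refine ⟨σ, hσ, φ, fun y => ?_⟩
    rw [tendsto_iff_ultrafilter]
    intro U hU
    obtain ⟨ψ, -, hψ⟩ := exists_pointwise_limit_ultrafilter U (fun k => hg (σ k))
    have hmem : ψ - φ ∈ Z := by
      have h1 := hall U ψ hU hψ
      have h2 := hall _ φ hyp hφ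
      have h3 : Z = ((Submodule.span ℝ (range g)).topologicalClosure : Set _) := rfl
      rw [h3] at h1 h2 ⊢
      exact Submodule.sub_mem _ h1 h2
    have h0 : ψ - φ = 0 := he _ hmem fun n => by
      have h1 := tendsto_nhds_unique (hψ (e n)) ((ha' n).mono_left hU)
      have h2 := tendsto_nhds_unique (hφ (e n)) ((ha' n).mono_left hyp)
      simp [h1, h2]
    rw [← sub_eq_zero.1 h0]
    exact hψ y
  · right
    push Not at hall
    obtain ⟨U, φ, hU, hlim, hnot⟩ := hall
    obtain ⟨d, hd, hball⟩ := Metric.isOpen_iff.1 isClosed_closure.isOpen_compl φ hnot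
    have hdist : ∀ z ∈ Submodule.span ℝ (range g), d ≤ ‖φ - z‖ := fun z hz => by
      by_contra hlt
      refine hball (a := z) ?_ (subset_closure hz)
      rw [Metric.mem_ball, dist_comm, dist_eq_norm]
      exact not_le.1 hlt
    -- Triangular recursion: Helly's lemma gives a point killed by all functionals chosen so far,
    -- and `U` gives a functional large at it and at all earlier points. Keeping `φ` large at every
    -- chosen point makes this second choice possible.
    obtain ⟨f, hf1, hf2⟩ := exists_seq_of_forall_finset_exists
      (fun x : ℕ × Y => ‖x.2‖ ≤ 1 ∧ d / 2 < φ x.2 ∧ d / 2 < g (σ x.1) x.2)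
      (fun x x' => g (σ x.1) x'.2 = 0 ∧ d / 2 < g (σ x'.1) x.2) (fun s hs => by
        obtain ⟨y, hy1, hy2, hy3⟩ := exists_apply_eq_zero_half_lt_apply
          (fun x : s => g (σ x.1.1)) φ hd (fun z hz => hdist z
            (Submodule.span_mono (range_subset_iff.2 fun x => mem_range_self _) hz))
        have hev : ∀ᶠ k in (U : Filter ℕ), d / 2 < g (σ k) y ∧ ∀ x ∈ s, d / 2 < g (σ k) x.2 :=
          ((hlim y).eventually_const_lt hy3).and
            ((Filter.eventually_all_finset s).2 fun x hx =>
              (hlim x.2).eventually_const_lt (hs x hx).2.1)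
        obtain ⟨k, hk1, hk2⟩ := hev.exists
        exact ⟨(k, y), ⟨hy1, hy3, hk1⟩, fun x hx => ⟨hy2 ⟨x, hx⟩, hk2 x hx⟩⟩)
    refine ⟨fun n => σ (f n).1, fun n => (f n).2, d / 2, by positivity, fun i => (hf1 i).1,
      fun i j hij => ?_, fun i j hji => (hf2 j i hji).1⟩
    rcases hij.eq_or_lt with rfl | hlt
    · exact (hf1 i).2.2.le
    · exact (hf2 i j hlt).2.le

/-! ### Convex blocks and stable oscillation -/

/-- `h` is an eventual sequence of convex combinations of tails of `g`. -/
def IsConvexBlock {E : Type*} [AddCommGroup E] [Module ℝ E] (h g : ℕ → E) : Prop :=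
  ∀ N, ∀ᶠ k in atTop, h k ∈ convexHull ℝ (g '' Ici N)

namespace IsConvexBlock

variable {E : Type*} [AddCommGroup E] [Module ℝ E] {f g h : ℕ → E}

theorem comp_tendsto (g : ℕ → E) {M : ℕ → ℕ} (hM : Tendsto M atTop atTop) :
    IsConvexBlock (g ∘ M) g := fun N => by
  filter_upwards [hM.eventually_ge_atTop N] with k hk
  exact subset_convexHull ℝ _ (mem_image_of_mem g hk)

theorem refl (g : ℕ → E) : IsConvexBlock g g := comp_tendsto g tendsto_id

theorem convexHull_tail_subset (hg : IsConvexBlock h g) (N : ℕ) :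
    ∃ K, convexHull ℝ (h '' Ici K) ⊆ convexHull ℝ (g '' Ici N) := by
  obtain ⟨K, hK⟩ := eventually_atTop.1 (hg N)
  exact ⟨K, convexHull_min (image_subset_iff.2 hK) (convex_convexHull ℝ _)⟩

theorem trans (hg : IsConvexBlock h g) (gf : IsConvexBlock g f) : IsConvexBlock h f := fun N => by
  obtain ⟨K, hK⟩ := gf.convexHull_tail_subset N
  filter_upwards [hg K] with k hk using hK hk

/-- The `k`-th term comes from a far part of `a k`, chosen in the hulls of the `k`-tails of `a 0, …,
a k` simultaneously. -/
theorem exists_diagonal (a : ℕ → ℕ → E) (ha : ∀ n, IsConvexBlock (a (n + 1)) (a n)) :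
    ∃ b, ∀ n, IsConvexBlock b (a n) := by
  have hle : ∀ {m n}, m ≤ n → IsConvexBlock (a n) (a m) := fun {m n} hmn => by
    induction n, hmn using Nat.le_induction with
    | base => exact refl _
    | succ n _ ih => exact (ha n).trans ih
  have hex : ∀ k, ∃ x, ∀ j ≤ k, x ∈ convexHull ℝ (a j '' Ici k) := fun k => by
    have : ∀ᶠ i in atTop, ∀ j ∈ Finset.range (k + 1), a k i ∈ convexHull ℝ (a j '' Ici k) :=
      (Filter.eventually_all_finset _).2 fun j hj =>
        hle (Nat.lt_succ_iff.1 (Finset.mem_range.1 hj)) k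
    obtain ⟨i, hi⟩ := this.exists
    exact ⟨a k i, fun j hj => hi j (Finset.mem_range.2 (Nat.lt_succ_of_le hj))⟩
  choose b hb using hex
  refine ⟨b, fun n N => ?_⟩
  filter_upwards [eventually_ge_atTop (max n N)] with k hk
  exact convexHull_mono (image_mono (Ici_subset_Ici.2 ((le_max_right _ _).trans hk)))
    (hb k n ((le_max_left _ _).trans hk))

end IsConvexBlock

/-- A monotone function on a relation closed under countable descent stabilises below any point. -/
theorem exists_stable_of_countably_directed {α : Type*} {r : α → α → Prop}
    (hrefl : ∀ a, r a a) (htrans : ∀ a b c, r a b → r b c → r a c)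
    (hseq : ∀ a : ℕ → α, (∀ n, r (a (n + 1)) (a n)) → ∃ b, ∀ n, r b (a n))
    (F : α → ℝ≥0∞) (hF : ∀ a b, r a b → F a ≤ F b) (a₀ : α) :
    ∃ b, r b a₀ ∧ ∀ c, r c b → F c = F b := by
  have hnext : ∀ (n : ℕ) (a : α), ∃ b, r b a ∧ ∀ c, r c a → F b ≤ F c + ((n : ℝ≥0∞) + 1)⁻¹ := by
    intro n a
    -- An infinite infimum makes `F` constantly infinite below `a`, so `a` itself serves; otherwise
    -- the infimum is approached within `1 / (n + 1)`.
    by_cases htop : (⨅ c : {c // r c a}, F c) = ∞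
    · refine ⟨a, hrefl a, fun c hc => ?_⟩
      have : F c = ∞ := (iInf_eq_top.1 htop) ⟨c, hc⟩
      simp [this]
    · have hlt : (⨅ c : {c // r c a}, F c) < (⨅ c : {c // r c a}, F c) + ((n : ℝ≥0∞) + 1)⁻¹ :=
        ENNReal.lt_add_right htop (by simp)
      have : Nonempty {c // r c a} := ⟨⟨a, hrefl a⟩⟩
      obtain ⟨b, hb⟩ := exists_lt_of_ciInf_lt hlt
      refine ⟨b, b.2, fun c hc => hb.le.trans ?_⟩
      gcongr
      exact iInf_le (fun c : {c // r c a} => F c) ⟨c, hc⟩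
  choose next hn1 hn2 using hnext
  let a : ℕ → α := fun n => Nat.rec a₀ (fun n x => next n x) n
  obtain ⟨b, hb⟩ := hseq a fun n => hn1 n (a n)
  refine ⟨b, hb 0, fun c hc => le_antisymm (hF _ _ hc) ?_⟩
  have hle : ∀ n : ℕ, F b ≤ F c + ((n : ℝ≥0∞) + 1)⁻¹ := fun n =>
    (hF _ _ (hb (n + 1))).trans (hn2 n (a n) c (htrans _ _ _ hc (hb n)))
  have hlim : Tendsto (fun n : ℕ => F c + ((n : ℝ≥0∞) + 1)⁻¹) atTop (𝓝 (F c + 0)) := by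
    refine Tendsto.const_add _ ?_
    have := (tendsto_add_atTop_iff_nat 1).2 ENNReal.tendsto_inv_nat_nhds_zero
    simpa using this
  simpa using ge_of_tendsto' hlim hle

/-- The largest oscillation of a sequence of functionals at a point of the unit ball. -/
noncomputable def pointwiseOsc (h : ℕ → StrongDual ℝ Y) : ℝ≥0∞ :=
  ⨆ y : Metric.closedBall (0 : Y) 1, ⨅ N : ℕ, Metric.ediam ((fun n => h n y) '' Ici N)

/-- Evaluation is linear, and passing to the convex hull does not increase the diameter. -/
theorem pointwiseOsc_mono {h g : ℕ → StrongDual ℝ Y} (hg : IsConvexBlock h g) :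
    pointwiseOsc h ≤ pointwiseOsc g := by
  refine iSup_mono fun y => le_iInf fun N => ?_
  obtain ⟨K, hK⟩ := hg.convexHull_tail_subset N
  refine (iInf_le _ K).trans ?_
  have himg : ∀ (f : ℕ → StrongDual ℝ Y) (s : Set ℕ),
      (fun n => f n (y : Y)) '' s = (ContinuousLinearMap.apply ℝ ℝ (y : Y)) '' (f '' s) :=
    fun f s => by rw [image_image]; rfl
  rw [← convexHull_ediam ((fun n => g n (y : Y)) '' Ici N), himg, himg]
  refine Metric.ediam_mono ?_
  rw [show (ContinuousLinearMap.apply ℝ ℝ (y : Y)) '' (g '' Ici N) =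
    (ContinuousLinearMap.apply ℝ ℝ (y : Y)).toLinearMap '' (g '' Ici N) from rfl,
    ← LinearMap.image_convexHull]
  exact image_mono ((subset_convexHull ℝ _).trans hK)

theorem pointwiseOsc_lt_top {h : ℕ → StrongDual ℝ Y} {C : ℝ} (hC : ∀ n, ‖h n‖ ≤ C) :
    pointwiseOsc h < ∞ := by
  refine lt_of_le_of_lt (b := ENNReal.ofReal (2 * C)) (iSup_le fun y => (iInf_le _ 0).trans ?_)
    ENNReal.ofReal_lt_top
  refine Metric.ediam_le ?_
  rintro _ ⟨m, -, rfl⟩ _ ⟨n, -, rfl⟩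
  rw [edist_dist]
  refine ENNReal.ofReal_le_ofReal ?_
  have hy : ‖(y : Y)‖ ≤ 1 := mem_closedBall_zero_iff.1 y.2
  have hb : ∀ k, |h k y| ≤ C := fun k => by
    have := (h k).le_of_opNorm_le_of_le (hC k) hy
    simpa using this
  rw [Real.dist_eq]
  have h1 := abs_le.1 (hb m)
  have h2 := abs_le.1 (hb n)
  rw [abs_le]
  constructor <;> linarith

theorem exists_dist_le_of_pointwiseOsc_lt {h : ℕ → StrongDual ℝ Y} {c : ℝ}
    (hc : pointwiseOsc h < ENNReal.ofReal c) {y : Y} (hy : ‖y‖ ≤ 1) :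
    ∃ N, ∀ a ≥ N, ∀ b ≥ N, |h a y - h b y| ≤ c := by
  have hc0 : 0 ≤ c := by
    by_contra hneg
    simp [ENNReal.ofReal_of_nonpos (not_le.1 hneg).le] at hc
  have h1 := (le_iSup (fun y : Metric.closedBall (0 : Y) 1 =>
    ⨅ N : ℕ, Metric.ediam ((fun n => h n y) '' Ici N)) ⟨y, by simpa using hy⟩).trans_lt hc
  obtain ⟨N, hN⟩ := exists_lt_of_ciInf_lt h1
  refine ⟨N, fun a ha b hb => ?_⟩
  have h2 := (Metric.edist_le_ediam_of_mem (mem_image_of_mem (fun n => h n y) ha)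
    (mem_image_of_mem (fun n => h n y) hb)).trans hN.le
  rw [edist_dist, ENNReal.ofReal_le_ofReal_iff hc0, Real.dist_eq] at h2
  exact h2

theorem exists_lt_sub_of_lt_pointwiseOsc {h : ℕ → StrongDual ℝ Y} {c : ℝ}
    (hc : ENNReal.ofReal c < pointwiseOsc h) :
    ∃ y : Y, ‖y‖ ≤ 1 ∧ ∀ N, ∃ a ≥ N, ∃ b ≥ N, c < h a y - h b y := by
  obtain ⟨y, hy⟩ := lt_iSup_iff.1 hc
  refine ⟨y, mem_closedBall_zero_iff.1 y.2, fun N => ?_⟩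
  have h1 := hy.trans_le (iInf_le _ N)
  have key : ∃ a ≥ N, ∃ b ≥ N, c < |h a y - h b y| := by
    by_contra! hcon
    refine h1.not_ge (Metric.ediam_le ?_)
    rintro _ ⟨m, hm, rfl⟩ _ ⟨n, hn, rfl⟩
    rw [edist_dist, Real.dist_eq]
    exact ENNReal.ofReal_le_ofReal (hcon m hm n hn)
  obtain ⟨a, ha, b, hb, hab⟩ := key
  rcases lt_abs.1 hab with h' | h'
  · exact ⟨a, ha, b, hb, h'⟩
  · exact ⟨b, hb, a, ha, by linarith⟩

end JosefsonNissenzweig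

/-! ### Dyadic trees and the Josefson–Nissenzweig theorem -/

section JosefsonNissenzweigTree

open scoped ENNReal

variable {Y : Type u} [NormedAddCommGroup Y] [NormedSpace ℝ Y]

/-- If all convex blocks of `h` have the same oscillation `e`, then finitely many subsequences of
`h` oscillate simultaneously at a single point of the unit ball. -/
theorem exists_simultaneous_split {h : ℕ → StrongDual ℝ Y} {C e : ℝ} (hC : ∀ n, ‖h n‖ ≤ C)
    (he : 0 < e) (hosc : ∀ h', IsConvexBlock h' h → pointwiseOsc h' = ENNReal.ofReal e)
    (S : Finset (ℕ → ℕ)) (hne : S.Nonempty) (hS : ∀ M ∈ S, Tendsto M atTop atTop) :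
    ∃ (y : Y) (p q : ℕ → ℕ), ‖y‖ ≤ 1 ∧ Tendsto p atTop atTop ∧ Tendsto q atTop atTop ∧
      ∀ M ∈ S, ∀ n n', e / 2 ≤ h (M (p n)) y - h (M (q n')) y := by
  classical
  have hcard : (0 : ℝ) < S.card := by exact_mod_cast hne.card_pos
  set m : ℝ := (S.card : ℝ) with hm
  have hm1 : (1 : ℝ) ≤ m := Nat.one_le_cast.2 hne.card_pos
  set η : ℝ := e / (8 * m) with hη
  have hη0 : 0 < η := by positivity
  have hηm : m * η = e / 8 := by rw [hη]; field_simp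
  -- The average of the subsequences is again a convex block, so it oscillates by almost `e` at some
  -- `y`. No single subsequence exceeds `e + η`, so each must contribute at least `m * (e - η) - (m
  -- - 1) * (e + η) > e - 2 * m * η = 3 * e / 4`.
  set u : ℕ → StrongDual ℝ Y := fun n => m⁻¹ • ∑ M ∈ S, h (M n) with hu
  have hublock : IsConvexBlock u h := fun N => by
    have hev : ∀ᶠ n in atTop, ∀ M ∈ S, N ≤ M n :=
      (Filter.eventually_all_finset S).2 fun M hM => (hS M hM).eventually_ge_atTop N
    filter_upwards [hev] with n hn
    rw [hu]
    simp only [Finset.smul_sum]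
    refine (convex_convexHull ℝ _).sum_mem (fun _ _ => by positivity) ?_
      fun M hM => subset_convexHull ℝ _ (mem_image_of_mem h (hn M hM))
    rw [Finset.sum_const, nsmul_eq_mul, ← hm]
    exact mul_inv_cancel₀ hcard.ne'
  obtain ⟨y, hy, hlow⟩ := exists_lt_sub_of_lt_pointwiseOsc (h := u) (c := e - η) (by
    rw [hosc u hublock, ENNReal.ofReal_lt_ofReal_iff he]; linarith)
  have hup : ∀ M ∈ S, ∃ N, ∀ a ≥ N, ∀ b ≥ N, |h (M a) y - h (M b) y| ≤ e + η := fun M hM =>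
    exists_dist_le_of_pointwiseOsc_lt (h := h ∘ M) (by
      rw [hosc _ (IsConvexBlock.comp_tendsto h (hS M hM)),
        ENNReal.ofReal_lt_ofReal_iff (by positivity)]; linarith) hy
  choose! N hN using hup
  have hpair : ∀ k, ∃ a b, k ≤ a ∧ k ≤ b ∧ ∀ M ∈ S, 3 * e / 4 ≤ h (M a) y - h (M b) y := by
    intro k
    obtain ⟨a, ha, b, hb, hab⟩ := hlow (max k (S.sup N))
    refine ⟨a, b, (le_max_left _ _).trans ha, (le_max_left _ _).trans hb, fun M hM => ?_⟩
    have hsum : u a y - u b y = m⁻¹ * ∑ M ∈ S, (h (M a) y - h (M b) y) := by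
      simp [hu, Finset.sum_sub_distrib, mul_sub]
    have h1 : m * (e - η) < ∑ M ∈ S, (h (M a) y - h (M b) y) := by
      rw [hsum, inv_mul_eq_div, lt_div_iff₀ hcard] at hab
      linarith
    rw [← Finset.add_sum_erase S _ hM] at h1
    have h2 : ∑ M' ∈ S.erase M, (h (M' a) y - h (M' b) y) ≤ (m - 1) * (e + η) := by
      refine (Finset.sum_le_card_nsmul _ _ (e + η) fun M' hM' => ?_).trans ?_
      · have hM'S := Finset.mem_of_mem_erase hM'
        have hle : N M' ≤ max k (S.sup N) := (Finset.le_sup hM'S).trans (le_max_right _ _)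
        exact (le_abs_self _).trans (hN M' hM'S a (hle.trans ha) b (hle.trans hb))
      · rw [Finset.card_erase_of_mem hM, nsmul_eq_mul, Nat.cast_sub hne.card_pos, ← hm]
        simp
    nlinarith
  choose a b ha hb hab using hpair
  have hbdd : ∀ n, h n y ∈ Icc (-C) C := fun n => by
    have := (h n).le_of_opNorm_le_of_le (hC n) hy
    rw [mul_one, Real.norm_eq_abs, abs_le] at this
    exact this
  let U : Ultrafilter ℕ := hyperfilter ℕ
  have hU : (U : Filter ℕ) ≤ atTop := by
    rw [← Nat.cofinite_eq_atTop]; exact hyperfilter_le_cofinite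
  have hlim : ∀ x : ℕ → ℕ, ∃ α, Tendsto (fun k => h (x k) y) U (𝓝 α) := fun x => by
    obtain ⟨α, -, hα⟩ := isCompact_Icc.ultrafilter_le_nhds (U.map fun k => h (x k) y) (by
      rw [le_principal_iff, Ultrafilter.mem_coe, Ultrafilter.mem_map]
      exact univ_mem' fun k => hbdd _)
    exact ⟨α, hα⟩
  -- Passing to limits along `U` decouples the two indices: each value is kept within `e / 8` of its
  -- limit, and the limits differ by `3 * e / 4`, leaving `e / 2` for arbitrary `n` and `n'`.
  choose α hα using fun M : ℕ → ℕ => hlim (M ∘ a)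
  choose β hβ using fun M : ℕ → ℕ => hlim (M ∘ b)
  have hαβ : ∀ M ∈ S, 3 * e / 4 ≤ α M - β M := fun M hM =>
    ge_of_tendsto' ((hα M).sub (hβ M)) fun k => hab k M hM
  have hev : ∀ᶠ k in (U : Filter ℕ), ∀ M ∈ S,
      α M - e / 8 < h (M (a k)) y ∧ h (M (b k)) y < β M + e / 8 :=
    (Filter.eventually_all_finset S).2 fun M _ =>
      ((hα M).eventually_const_lt (by linarith)).and
        ((hβ M).eventually_lt_const (by linarith))
  have hsel : ∀ n, ∃ k ≥ n, ∀ M ∈ S,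
      α M - e / 8 < h (M (a k)) y ∧ h (M (b k)) y < β M + e / 8 := fun n =>
    ((Filter.Eventually.filter_mono hU (eventually_ge_atTop n)).and hev).exists
  choose k hk1 hk2 using hsel
  refine ⟨y, fun n => a (k n), fun n => b (k n), hy, ?_, ?_, fun M hM n n' => ?_⟩
  · exact tendsto_atTop_mono (fun n => (hk1 n).trans (ha _)) tendsto_id
  · exact tendsto_atTop_mono (fun n => (hk1 n).trans (hb _)) tendsto_id
  · have h1 := (hk2 n M hM).1
    have h2 := (hk2 n' M hM).2
    have h3 := hαβ M hM
    linarith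

/-- The composition of the first `k` maps chosen by the branch `s`. -/
def branchMap (c : ℕ → Bool → ℕ → ℕ) (s : ℕ → Bool) : ℕ → ℕ → ℕ
  | 0 => id
  | k + 1 => branchMap c s k ∘ c k (s k)

theorem branchMap_congr (c : ℕ → Bool → ℕ → ℕ) {s t : ℕ → Bool} (k : ℕ)
    (hst : ∀ j < k, s j = t j) : branchMap c s k = branchMap c t k := by
  induction k with
  | zero => rfl
  | succ k ih =>
    simp only [branchMap, hst k k.lt_succ_self, ih fun j hj => hst j (hj.trans k.lt_succ_self)]

theorem exists_branchMap_eq (c : ℕ → Bool → ℕ → ℕ) (s : ℕ → Bool) {k m : ℕ} (hkm : k < m)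
    (x : ℕ) : ∃ n, branchMap c s m x = branchMap c s k (c k (s k) n) := by
  induction m, hkm using Nat.le_induction generalizing x with
  | base => exact ⟨x, rfl⟩
  | succ m _ ih => exact ih (c m (s m) x)

/-- A dyadic tree of subsequences split by a sequence in the unit ball. -/
theorem exists_dyadic_tree {h : ℕ → StrongDual ℝ Y} {C e : ℝ} (hC : ∀ n, ‖h n‖ ≤ C)
    (he : 0 < e) (hosc : ∀ h', IsConvexBlock h' h → pointwiseOsc h' = ENNReal.ofReal e) :
    ∃ (y : ℕ → Y) (c : ℕ → Bool → ℕ → ℕ), (∀ k, ‖y k‖ ≤ 1) ∧ ∀ k s n n',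
      e / 2 ≤ h (branchMap c s k (c k true n)) (y k) - h (branchMap c s k (c k false n')) (y k) := by
  classical
  let A := {S : Finset (ℕ → ℕ) // S.Nonempty ∧ ∀ M ∈ S, Tendsto M atTop atTop}
  choose y p q hy hp hq hpq using fun S : A =>
    exists_simultaneous_split hC he hosc S.1 S.2.1 S.2.2
  -- Every node of a level is split by the same point `y S`, giving two children per node.
  let next : A → A := fun S => ⟨S.1.image (· ∘ p S) ∪ S.1.image (· ∘ q S),
    (S.2.1.image _).mono Finset.subset_union_left, fun M hM => by
      rcases Finset.mem_union.1 hM with hM | hM <;>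
        obtain ⟨M', hM', rfl⟩ := Finset.mem_image.1 hM
      · exact (S.2.2 M' hM').comp (hp S)
      · exact (S.2.2 M' hM').comp (hq S)⟩
  let S : ℕ → A := fun n => Nat.rec
    ⟨{id}, Finset.singleton_nonempty _, fun M hM => by
      rw [Finset.mem_singleton.1 hM]; exact tendsto_id⟩ (fun _ T => next T) n
  let c : ℕ → Bool → ℕ → ℕ := fun k b => bif b then p (S k) else q (S k)
  have hmem : ∀ s k, branchMap c s k ∈ (S k).1 := by
    intro s k
    induction k with
    | zero => exact Finset.mem_singleton_self _
    | succ k ih =>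
      change branchMap c s k ∘ c k (s k) ∈ _ ∪ _
      cases hs : s k
      · exact Finset.mem_union_right _ (Finset.mem_image_of_mem (· ∘ q (S k)) ih)
      · exact Finset.mem_union_left _ (Finset.mem_image_of_mem (· ∘ p (S k)) ih)
  exact ⟨fun k => y (S k), c, fun k => hy _, fun k s n n' => hpq (S k) _ (hmem s k) n n'⟩

/-! ### Rademacher averages -/

/-- The sign `± 1` attached to a bit. -/
def bitSign (b : Bool) : ℝ := bif b then 1 else -1

theorem bitSign_not (b : Bool) : bitSign (!b) = -bitSign b := by cases b <;> simp [bitSign]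

theorem bitSign_mul_self (b : Bool) : bitSign b * bitSign b = 1 := by cases b <;> simp [bitSign]

/-- Flipping one coordinate of a bit string. -/
def flipBit {m : ℕ} (k : Fin m) (s : Fin m → Bool) : Fin m → Bool := Function.update s k (!s k)

theorem flipBit_self {m : ℕ} (k : Fin m) (s : Fin m → Bool) : flipBit k s k = !s k := by
  simp [flipBit]

theorem flipBit_of_ne {m : ℕ} {k l : Fin m} (h : l ≠ k) (s : Fin m → Bool) :
    flipBit k s l = s l := by
  simp [flipBit, h]

theorem flipBit_involutive {m : ℕ} (k : Fin m) : Function.Involutive (flipBit k) := fun s => by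
  ext l
  by_cases h : l = k
  · subst h; simp [flipBit]
  · simp [flipBit, h]

theorem sum_flipBit {m : ℕ} (k : Fin m) (f : (Fin m → Bool) → ℝ) :
    ∑ s, f (flipBit k s) = ∑ s, f s :=
  Equiv.sum_comp (flipBit_involutive k).toPerm f

theorem sum_bitSign_mul_bitSign {m : ℕ} (k l : Fin m) :
    ∑ s : Fin m → Bool, bitSign (s k) * bitSign (s l) = if k = l then 2 ^ m else 0 := by
  split_ifs with h
  · subst h
    simp [bitSign_mul_self]
  · have h1 := sum_flipBit k fun s => bitSign (s k) * bitSign (s l)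
    simp only [flipBit_self, flipBit_of_ne (Ne.symm h), bitSign_not, neg_mul,
      Finset.sum_neg_distrib] at h1
    linarith

/-- Bessel's inequality for the Rademacher system on the discrete cube. -/
theorem sum_sq_rademacher_le {m : ℕ} (F : (Fin m → Bool) → ℝ) {B : ℝ} (hF : ∀ s, |F s| ≤ B) :
    ∑ k : Fin m, ((2 ^ m : ℝ)⁻¹ * ∑ s, bitSign (s k) * F s) ^ 2 ≤ B ^ 2 := by
  set ρ : Fin m → ℝ := fun k => (2 ^ m : ℝ)⁻¹ * ∑ s, bitSign (s k) * F s with hρ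
  have hpos : (0 : ℝ) < 2 ^ m := by positivity
  have hρ' : ∀ k, ∑ s, bitSign (s k) * F s = 2 ^ m * ρ k := fun k => by
    rw [hρ]; field_simp
  -- Bessel's inequality is the nonnegativity of the squared distance from `F` to its Rademacher
  -- projection.
  have hnn : 0 ≤ ∑ s : Fin m → Bool, (F s - ∑ k, ρ k * bitSign (s k)) ^ 2 :=
    Finset.sum_nonneg fun s _ => sq_nonneg _
  have hcross : ∑ s : Fin m → Bool, F s * ∑ k, ρ k * bitSign (s k) = 2 ^ m * ∑ k, ρ k ^ 2 := by
    simp_rw [Finset.mul_sum]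
    rw [Finset.sum_comm]
    refine Finset.sum_congr rfl fun k _ => ?_
    rw [show (2 : ℝ) ^ m * ρ k ^ 2 = ρ k * (2 ^ m * ρ k) by ring, ← hρ' k, Finset.mul_sum]
    exact Finset.sum_congr rfl fun s _ => by ring
  have hsq : ∑ s : Fin m → Bool, (∑ k, ρ k * bitSign (s k)) ^ 2 = 2 ^ m * ∑ k, ρ k ^ 2 := by
    simp_rw [sq, Finset.sum_mul_sum]
    rw [Finset.sum_comm, Finset.mul_sum]
    refine Finset.sum_congr rfl fun k _ => ?_
    rw [Finset.sum_comm]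
    have : ∀ l, ∑ s : Fin m → Bool, ρ k * bitSign (s k) * (ρ l * bitSign (s l)) =
        ρ k * ρ l * if k = l then 2 ^ m else 0 := fun l => by
      rw [← sum_bitSign_mul_bitSign, Finset.mul_sum]
      exact Finset.sum_congr rfl fun s _ => by ring
    simp_rw [this]
    simp
    ring
  have hexp : ∑ s : Fin m → Bool, (F s - ∑ k, ρ k * bitSign (s k)) ^ 2 =
      ∑ s, F s ^ 2 - 2 * ∑ s, F s * ∑ k, ρ k * bitSign (s k) +
        ∑ s : Fin m → Bool, (∑ k, ρ k * bitSign (s k)) ^ 2 := by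
    rw [Finset.mul_sum, ← Finset.sum_sub_distrib, ← Finset.sum_add_distrib]
    exact Finset.sum_congr rfl fun s _ => by ring
  have hFB : ∑ s : Fin m → Bool, F s ^ 2 ≤ 2 ^ m * B ^ 2 := by
    refine (Finset.sum_le_card_nsmul _ _ (B ^ 2) fun s _ => ?_).trans (by simp)
    rw [← sq_abs]
    exact pow_le_pow_left₀ (abs_nonneg _) (hF s) 2
  have : (2 : ℝ) ^ m * ∑ k, ρ k ^ 2 ≤ 2 ^ m * B ^ 2 := by linarith
  exact le_of_mul_le_mul_left this hpos

/-- A bounded sequence of functionals all of whose convex blocks have the same positive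
oscillation yields a pointwise null sequence of functionals bounded away from zero. -/
theorem exists_null_of_stable_pointwiseOsc {h : ℕ → StrongDual ℝ Y} {C e : ℝ}
    (hC : ∀ n, ‖h n‖ ≤ C) (he : 0 < e)
    (hosc : ∀ h', IsConvexBlock h' h → pointwiseOsc h' = ENNReal.ofReal e) :
    ∃ x : ℕ → StrongDual ℝ Y, (∀ y, Tendsto (fun n => x n y) atTop (𝓝 0)) ∧
      ∃ c > 0, ∀ n, c ≤ ‖x n‖ := by
  obtain ⟨y, c, hy, htree⟩ := exists_dyadic_tree hC he hosc
  have hC0 : 0 ≤ C := (norm_nonneg _).trans (hC 0)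
  let ext : ∀ {m}, (Fin m → Bool) → ℕ → Bool := fun {m} s j =>
    if hj : j < m then s ⟨j, hj⟩ else false
  have hext : ∀ {m} (s : Fin m → Bool) (k : Fin m), ext s k = s k := fun s k => by
    simp [ext]
  -- `G m s` is the functional at the leaf `s` of depth `m`, where the padding bits of `ext s` are
  -- never read. `R k m` is the `k`-th Rademacher coefficient of the leaves.
  let G : ∀ m, (Fin m → Bool) → StrongDual ℝ Y := fun m s => h (branchMap c (ext s) m 0)
  let R : ℕ → ℕ → StrongDual ℝ Y := fun k m =>
    if hk : k < m then (2 ^ m : ℝ)⁻¹ • ∑ s : Fin m → Bool, bitSign (s ⟨k, hk⟩) • G m s else 0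
  have hRapp : ∀ m (k : Fin m) z, R k m z = (2 ^ m : ℝ)⁻¹ * ∑ s, bitSign (s k) * G m s z :=
    fun m k z => by simp [R]
  have hbessel : ∀ m z, ∑ k : Fin m, (R k m z) ^ 2 ≤ (C * ‖z‖) ^ 2 := fun m z => by
    simp_rw [hRapp]
    exact sum_sq_rademacher_le (fun s => G m s z) fun s => (h _).le_of_opNorm_le (hC _) z
  have hRnorm : ∀ k m, ‖R k m‖ ≤ C := fun k m => by
    refine ContinuousLinearMap.opNorm_le_bound _ hC0 fun z => ?_
    by_cases hk : k < m
    · have h1 := (Finset.single_le_sum (f := fun k : Fin m => (R k m z) ^ 2)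
        (fun _ _ => sq_nonneg _) (Finset.mem_univ ⟨k, hk⟩)).trans (hbessel m z)
      exact abs_le_of_sq_le_sq h1 (by positivity)
    · simp only [R, dif_neg hk]
      simpa using by positivity
  -- Flipping bit `k` keeps the node at level `k` and moves the leaf below its other child, which `y
  -- k` separates by `e / 2`. In the sum over all leaves each leaf enters once directly and once
  -- flipped, so the average is at least `e / 4`.
  have hRy : ∀ k m, k < m → e / 4 ≤ R k m (y k) := fun k m hk => by
    have hdiff : ∀ s : Fin m → Bool, e / 2 ≤
        bitSign (s ⟨k, hk⟩) * (G m s (y k) - G m (flipBit ⟨k, hk⟩ s) (y k)) := fun s => by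
      obtain ⟨n, hn⟩ := exists_branchMap_eq c (ext s) hk 0
      obtain ⟨n', hn'⟩ := exists_branchMap_eq c (ext (flipBit ⟨k, hk⟩ s)) hk 0
      rw [branchMap_congr c (t := ext s) k fun j hj => by
          rw [show j = ((⟨j, hj.trans hk⟩ : Fin m) : ℕ) from rfl, hext, hext, flipBit_of_ne]
          exact fun h => hj.ne (Fin.mk.inj_iff.1 h),
        show ext (flipBit ⟨k, hk⟩ s) k = !s ⟨k, hk⟩ from (hext _ ⟨k, hk⟩).trans
          (flipBit_self _ _)] at hn'
      rw [show ext s k = s ⟨k, hk⟩ from hext _ ⟨k, hk⟩] at hn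
      simp only [G]
      rw [hn, hn']
      cases hs : s ⟨k, hk⟩
      · have := htree k (ext s) n' n
        simp only [bitSign, Bool.not_false, cond_false]
        linarith
      · have := htree k (ext s) n n'
        simp only [bitSign, Bool.not_true, cond_true]
        linarith
    have hflip : ∑ s : Fin m → Bool, bitSign (s ⟨k, hk⟩) * G m (flipBit ⟨k, hk⟩ s) (y k) =
        -∑ s : Fin m → Bool, bitSign (s ⟨k, hk⟩) * G m s (y k) := by
      rw [← sum_flipBit ⟨k, hk⟩, ← Finset.sum_neg_distrib]
      refine Finset.sum_congr rfl fun s _ => ?_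
      rw [flipBit_involutive, flipBit_self, bitSign_not, neg_mul]
    have hsum : (2 : ℝ) ^ m * (e / 2) ≤ 2 * ∑ s : Fin m → Bool, bitSign (s ⟨k, hk⟩) * G m s (y k) := by
      calc (2 : ℝ) ^ m * (e / 2) = ∑ _s : Fin m → Bool, e / 2 := by simp
        _ ≤ ∑ s : Fin m → Bool,
            bitSign (s ⟨k, hk⟩) * (G m s (y k) - G m (flipBit ⟨k, hk⟩ s) (y k)) :=
          Finset.sum_le_sum fun s _ => hdiff s
        _ = _ := by
          simp_rw [mul_sub]
          rw [Finset.sum_sub_distrib, hflip]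
          ring
    rw [hRapp m ⟨k, hk⟩, inv_mul_eq_div, le_div_iff₀ (by positivity)]
    linarith
  let U : Ultrafilter ℕ := hyperfilter ℕ
  have hU : (U : Filter ℕ) ≤ atTop := by
    rw [← Nat.cofinite_eq_atTop]; exact hyperfilter_le_cofinite
  choose x _ hx using fun k => exists_pointwise_limit_ultrafilter U (hRnorm k)
  refine ⟨x, fun z => ?_, e / 4, by positivity, fun k => ?_⟩
  · have hsum : Summable fun k => (x k z) ^ 2 := by
      refine summable_of_sum_range_le (c := (C * ‖z‖) ^ 2) (fun _ => sq_nonneg _) fun n => ?_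
      have hlim : Tendsto (fun m => ∑ k ∈ Finset.range n, (R k m z) ^ 2) U
          (𝓝 (∑ k ∈ Finset.range n, (x k z) ^ 2)) :=
        tendsto_finsetSum _ fun k _ => (hx k z).pow 2
      refine le_of_tendsto hlim (hU ?_)
      filter_upwards [eventually_ge_atTop n] with m hm
      refine le_trans ?_ (hbessel m z)
      rw [Fin.sum_univ_eq_sum_range (fun k => (R k m z) ^ 2)]
      exact Finset.sum_le_sum_of_subset_of_nonneg (Finset.range_mono hm) fun _ _ _ => sq_nonneg _
    have := hsum.tendsto_atTop_zero.sqrt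
    simp only [Real.sqrt_sq_eq_abs, Real.sqrt_zero] at this
    exact (tendsto_zero_iff_abs_tendsto_zero _).2 this
  · have h1 : e / 4 ≤ x k (y k) := ge_of_tendsto (hx k (y k)) (hU (by
      filter_upwards [eventually_gt_atTop k] with m hm using hRy k m hm))
    have h2 := (x k).le_of_opNorm_le_of_le le_rfl (hy k)
    rw [mul_one] at h2
    exact h1.trans ((le_abs_self _).trans h2)

/-- Pass to a convex block of stable oscillation. If the oscillation is zero, the block is pointwise
Cauchy, while the triangular pattern keeps it from being Cauchy in norm; if it is positive, the
dyadic tree applies. -/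
theorem exists_null_of_separated {g : ℕ → StrongDual ℝ Y} {y : ℕ → Y} {C d : ℝ}
    (hC : ∀ n, ‖g n‖ ≤ C) (hd : 0 < d) (hy : ∀ i, ‖y i‖ ≤ 1)
    (hle : ∀ i j, i ≤ j → d ≤ g j (y i)) (hlt : ∀ i j, j < i → g j (y i) = 0) :
    ∃ x : ℕ → StrongDual ℝ Y, (∀ y, Tendsto (fun n => x n y) atTop (𝓝 0)) ∧
      ∃ c > 0, ∀ n, c ≤ ‖x n‖ := by
  obtain ⟨h, hhg, hstab⟩ := exists_stable_of_countably_directed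
    (r := IsConvexBlock (E := StrongDual ℝ Y))
    IsConvexBlock.refl (fun _ _ _ => IsConvexBlock.trans) IsConvexBlock.exists_diagonal
    pointwiseOsc (fun _ _ => pointwiseOsc_mono) g
  -- The shift puts every term, not only almost every one, in the hull of `g`.
  obtain ⟨K, hK⟩ := eventually_atTop.1 (hhg 0)
  have hshift : IsConvexBlock (fun n => h (n + K)) h :=
    IsConvexBlock.comp_tendsto h (tendsto_add_atTop_nat K)
  set f : ℕ → StrongDual ℝ Y := fun n => h (n + K) with hf
  have hfg : IsConvexBlock f g := hshift.trans hhg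
  have hf0 : ∀ n, f n ∈ convexHull ℝ (g '' Ici 0) := fun n => hK _ (Nat.le_add_left _ _)
  have hfC : ∀ n, ‖f n‖ ≤ C := fun n => by
    have : convexHull ℝ (g '' Ici 0) ⊆ Metric.closedBall 0 C :=
      convexHull_min (by rintro _ ⟨k, -, rfl⟩; simpa using hC k) (convex_closedBall _ _)
    simpa using this (hf0 n)
  have hosc : ∀ h', IsConvexBlock h' f → pointwiseOsc h' = pointwiseOsc h :=
    fun h' hh' => hstab h' (hh'.trans hshift)
  have hfin : pointwiseOsc h ≠ ∞ := by
    rw [← hosc f (IsConvexBlock.refl f)]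
    exact (pointwiseOsc_lt_top hfC).ne
  rcases eq_or_ne (pointwiseOsc h) 0 with h0 | h0
  · have hzero : ∀ n, ∀ᶠ N in atTop, f n (y N) = 0 := by
      let Z : Submodule ℝ (StrongDual ℝ Y) :=
        { carrier := {z | ∀ᶠ N in atTop, z (y N) = 0}
          add_mem' := fun {a b} ha hb => by
            filter_upwards [ha, hb] with N h1 h2
            simp [h1, h2]
          zero_mem' := by simp
          smul_mem' := fun r z hz => by
            filter_upwards [hz] with N h1
            simp [h1] }
      intro n
      have hsub : convexHull ℝ (g '' Ici 0) ⊆ (Z : Set (StrongDual ℝ Y)) := by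
        refine convexHull_min ?_ Z.convex
        rintro _ ⟨k, -, rfl⟩
        change ∀ᶠ N in atTop, g k (y N) = 0
        filter_upwards [eventually_gt_atTop k] with N hN using hlt N k hN
      exact hsub (hf0 n)
    have hlarge : ∀ N, ∀ᶠ n in atTop, d ≤ f n (y N) := fun N => by
      filter_upwards [hfg N] with n hn
      have hsub : convexHull ℝ (g '' Ici N) ⊆ {z | d ≤ z (y N)} := by
        refine convexHull_min ?_ (convex_halfSpace_ge
          (ContinuousLinearMap.apply ℝ ℝ (y N)).toLinearMap.isLinear d)
        rintro _ ⟨k, hk, rfl⟩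
        exact hle N k hk
      exact hsub hn
    -- At a point `y N` where `f n` vanishes, all late terms are still at least `d`.
    have hm : ∀ n, ∃ m ≥ n, d ≤ ‖f m - f n‖ := fun n => by
      obtain ⟨N, hN⟩ := (hzero n).exists
      obtain ⟨m, hm1, hm2⟩ := ((hlarge N).and (eventually_ge_atTop n)).exists
      refine ⟨m, hm2, ?_⟩
      have h2 := (f m - f n).le_of_opNorm_le_of_le le_rfl (hy N)
      rw [sub_apply, hN, sub_zero, mul_one] at h2
      exact hm1.trans ((le_abs_self _).trans h2)
    choose m hm1 hm2 using hm
    have hball : ∀ z : Y, ‖z‖ ≤ 1 → Tendsto (fun n => (f (m n) - f n) z) atTop (𝓝 0) := by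
      intro z hz
      rw [Metric.tendsto_atTop]
      intro ε hε
      obtain ⟨N, hN⟩ := exists_dist_le_of_pointwiseOsc_lt (h := f) (c := ε / 2) (by
        rw [hosc f (IsConvexBlock.refl f), h0]; simpa using hε) hz
      refine ⟨N, fun n hn => ?_⟩
      rw [dist_zero_right, Real.norm_eq_abs]
      exact (hN (m n) (hn.trans (hm1 n)) n hn).trans_lt (half_lt_self hε)
    refine ⟨fun n => f (m n) - f n, fun z => ?_, d, hd, hm2⟩
    rcases eq_or_ne z 0 with rfl | hz
    · simp
    · have hz' : ‖z‖ ≠ 0 := norm_ne_zero_iff.2 hz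
      have := (hball (‖z‖⁻¹ • z) (by rw [norm_smul, norm_inv, norm_norm, inv_mul_cancel₀ hz'])).const_mul
        ‖z‖
      simpa [mul_inv_cancel_left₀ hz', ← mul_sub] using this
  · refine exists_null_of_stable_pointwiseOsc (e := (pointwiseOsc h).toReal) hfC
      (ENNReal.toReal_pos h0 hfin) fun h' hh' => ?_
    rw [ENNReal.ofReal_toReal hfin]
    exact hosc h' hh'

/-- The **Josefson–Nissenzweig theorem**: the dual of an infinite-dimensional normed space
contains a weak* null sequence of norm-one functionals. -/
theorem exists_norm_eq_one_tendsto_zero (hY : ¬ FiniteDimensional ℝ Y) :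
    ∃ x : ℕ → StrongDual ℝ Y, (∀ n, ‖x n‖ = 1) ∧
      ∀ y, Tendsto (fun n => x n y) atTop (𝓝 0) := by
  have hdual : ¬ FiniteDimensional ℝ (StrongDual ℝ Y) := fun hfin => hY <| by
    have : FiniteDimensional ℝ (StrongDual ℝ (StrongDual ℝ Y)) := inferInstance
    exact FiniteDimensional.of_injective
      (NormedSpace.inclusionInDoubleDualLi ℝ (E := Y)).toLinearMap
      (NormedSpace.inclusionInDoubleDualLi ℝ (E := Y)).injective
  suffices ∃ x : ℕ → StrongDual ℝ Y, (∀ y, Tendsto (fun n => x n y) atTop (𝓝 0)) ∧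
      ∃ c > 0, ∀ n, c ≤ ‖x n‖ by
    obtain ⟨x, hx, c, hc, hxc⟩ := this
    have hpos : ∀ n, 0 < ‖x n‖ := fun n => hc.trans_le (hxc n)
    refine ⟨fun n => ‖x n‖⁻¹ • x n, fun n => ?_, fun y => ?_⟩
    · rw [norm_smul, norm_inv, norm_norm, inv_mul_cancel₀ (hpos n).ne']
    · refine squeeze_zero_norm (a := fun n => c⁻¹ * |x n y|) (fun n => ?_) ?_
      · rw [smul_apply, smul_eq_mul, norm_mul, norm_inv, norm_norm,
          Real.norm_eq_abs]
        gcongr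
        exact hxc n
      · simpa using ((hx y).abs).const_mul c⁻¹
  -- Riesz's lemma: a bounded sequence with mutual distances at least 1.
  obtain ⟨C, g, -, hgC, hsep⟩ := exists_seq_norm_le_one_le_norm_sub (𝕜 := ℝ) hdual
  rcases exists_subseq_tendsto_or_separated hgC with
    ⟨σ, hσ, φ, hφ⟩ | ⟨σ, y, d, hd, hy, hle, hlt⟩
  · refine ⟨fun n => g (σ (n + 1)) - g (σ n), fun y => ?_, 1, one_pos, fun n =>
      hsep (hσ n.lt_succ_self).ne'⟩
    simpa using ((tendsto_add_atTop_iff_nat 1).2 (hφ y)).sub (hφ y)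
  · exact exists_null_of_separated (g := fun n => g (σ n)) (fun n => hgC _) hd hy hle hlt

end JosefsonNissenzweigTree

/-! ### Splitting of extensions by $c_0$ and lifting -/

section Lifting

theorem isClosed_czero : IsClosed (czero : Set EllInfty) := by
  refine isClosed_of_closure_subset fun x hx => ?_
  change Tendsto (fun n => x n) atTop (𝓝 0)
  rw [Metric.tendsto_atTop]
  intro ε hε
  obtain ⟨z, hz, hxz⟩ := Metric.mem_closure_iff.1 hx (ε / 2) (half_pos hε)
  obtain ⟨N, hN⟩ := (Metric.tendsto_atTop.1 (show Tendsto (fun n => z n) atTop (𝓝 0) from hz))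
    (ε / 2) (half_pos hε)
  refine ⟨N, fun n hn => ?_⟩
  have h1 : ‖x n - z n‖ ≤ ‖x - z‖ := lp.norm_apply_le_norm ENNReal.top_ne_zero (x - z) n
  have h2 := hN n hn
  rw [dist_eq_norm] at hxz
  rw [dist_zero_right] at h2 ⊢
  linarith [norm_le_norm_sub_add (x n) (z n)]

instance completeSpace_czero : CompleteSpace czero := isClosed_czero.completeSpace_coe

section

variable {X : Type*} [NormedAddCommGroup X] [NormedSpace ℝ X]

/-- The operator into `EllInfty` whose coordinates are a bounded sequence of functionals. -/
theorem exists_clm_ellInfty {g : ℕ → StrongDual ℝ X} {C : ℝ} (hg : ∀ n, ‖g n‖ ≤ C) :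
    ∃ S : X →L[ℝ] EllInfty, ∀ x n, S x n = g n x := by
  have hC : 0 ≤ C := (norm_nonneg _).trans (hg 0)
  have hb : ∀ x n, ‖g n x‖ ≤ C * ‖x‖ := fun x n => (g n).le_of_opNorm_le (hg n) x
  let S : X →ₗ[ℝ] EllInfty :=
    { toFun := fun x => ⟨fun n => g n x, memℓp_infty ⟨C * ‖x‖, by
        rintro _ ⟨n, rfl⟩
        exact hb x n⟩⟩
      map_add' := fun x y => by
        ext n
        exact (g n).map_add x y
      map_smul' := fun c x => by
        ext n
        exact (g n).map_smul c x }
  exact ⟨S.mkContinuous C fun x =>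
    lp.norm_le_of_forall_le (by positivity) fun n => hb x n, fun x n => rfl⟩

theorem exists_coordinate_functionals (S : X →L[ℝ] EllInfty) :
    ∃ s : ℕ → StrongDual ℝ X, (∀ n, ‖s n‖ ≤ ‖S‖) ∧ ∀ x n, s n x = S x n :=
  ⟨fun n => LinearMap.mkContinuous
      { toFun := fun x => S x n
        map_add' := fun x y => by simp
        map_smul' := fun c x => by simp } ‖S‖ fun x =>
      (lp.norm_apply_le_norm (E := fun _ : ℕ => ℝ) ENNReal.top_ne_zero (S x) n).trans
        (S.le_opNorm x),
    fun _ => LinearMap.mkContinuous_norm_le _ (norm_nonneg _) _, fun _ _ => rfl⟩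

/-- Operators from a subspace into `EllInfty` extend to the whole space. -/
theorem exists_extension_ellInfty (W : Submodule ℝ X) (f : W →L[ℝ] EllInfty) :
    ∃ F : X →L[ℝ] EllInfty, ∀ w : W, F w = f w := by
  obtain ⟨s, hs, hsf⟩ := exists_coordinate_functionals f
  choose g hg hnorm using fun n => exists_extension_norm_eq W (s n)
  obtain ⟨F, hF⟩ := exists_clm_ellInfty (g := g) (C := ‖f‖) fun n => (hnorm n).trans_le (hs n)
  refine ⟨F, fun w => ?_⟩
  ext n
  rw [hF, hg n w, hsf]

/-- Operators vanishing on the kernel of a quotient map of Banach spaces factor through it. -/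
theorem ContinuousLinearMap.exists_factor_of_surjective {Y E : Type*} [NormedAddCommGroup Y]
    [NormedSpace ℝ Y] [CompleteSpace X] [CompleteSpace Y] [AddCommGroup E] [Module ℝ E]
    [TopologicalSpace E] (p : X →L[ℝ] Y) (hp : Function.Surjective p) (F : X →L[ℝ] E)
    (hF : ∀ x, p x = 0 → F x = 0) : ∃ G : Y →L[ℝ] E, ∀ x, G (p x) = F x := by
  let G : Y →ₗ[ℝ] E := (LinearMap.ker p.toLinearMap).liftQ F.toLinearMap (fun x hx => hF x hx) ∘ₗ
    (p.toLinearMap.quotKerEquivOfSurjective hp).symm.toLinearMap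
  have hG : ∀ x, G (p x) = F x := fun x => by
    have : (p.toLinearMap.quotKerEquivOfSurjective hp).symm (p x) = Submodule.Quotient.mk x := by
      rw [LinearEquiv.symm_apply_eq]
      rfl
    simp only [G, LinearMap.comp_apply, LinearEquiv.coe_coe, this]
    rfl
  refine ⟨⟨G, ?_⟩, hG⟩
  -- By the open mapping theorem `p` is a topological quotient map.
  refine (p.isQuotientMap hp).continuous_iff.2 ?_
  rw [show (G.toFun ∘ p) = F from funext hG]
  exact F.continuous

end

variable {Y : Type u} [NormedAddCommGroup Y] [NormedSpace ℝ Y] [CompleteSpace Y]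

/-- Extend the inclusion $c_0\to\ell_\infty$ along `i` to `R` on `X`. Modulo $c_0$ it factors
through `p`; if `S` lifts the induced operator on `Y`, then `R - S ∘ p` takes values in $c_0$ and
inverts `i`. -/
theorem extEqZero_of_forall_lift
    (h : ∀ T : Y →L[ℝ] EllInfty ⧸ czero,
      ∃ S : Y →L[ℝ] EllInfty, ∀ y : Y, Submodule.Quotient.mk (S y) = T y) :
    ExtEqZero Y czero := by
  intro X _ _ _ i p hi hexact hp
  have hrange : IsClosed (range i) := by
    have : range i = p ⁻¹' {0} := by
      ext x
      exact (hexact x).symm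
    rw [this]
    exact isClosed_singleton.preimage p.continuous
  let e : czero ≃L[ℝ] LinearMap.range i.toLinearMap := i.equivRange hi hrange
  have he : ∀ z, (e z : X) = i z := fun z => rfl
  obtain ⟨R, hR⟩ := exists_extension_ellInfty (LinearMap.range i.toLinearMap)
    (czero.subtypeL.comp e.symm.toContinuousLinearMap)
  have hRi : ∀ z : czero, R (i z) = z := fun z => by
    rw [← he, hR]
    simp
  obtain ⟨T, hT⟩ := p.exists_factor_of_surjective hp (czero.mkQL.comp R) fun x hx => by
    obtain ⟨z, rfl⟩ := (hexact x).1 hx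
    change Submodule.Quotient.mk (R (i z)) = 0
    rw [hRi, Submodule.Quotient.mk_eq_zero]
    exact z.2
  obtain ⟨S, hS⟩ := h T
  have hmem : ∀ x, (R - S.comp p) x ∈ czero := fun x => by
    rw [← Submodule.Quotient.mk_eq_zero]
    change Submodule.Quotient.mk (R x - S (p x)) = 0
    rw [Submodule.Quotient.mk_sub, hS, hT]
    exact sub_self _
  refine ⟨(R - S.comp p).codRestrict czero hmem, fun z => Subtype.ext ?_⟩
  change R (i z) - S (p (i z)) = z
  rw [(hexact (i z)).2 ⟨z, rfl⟩, hRi, map_zero, sub_zero]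

/-- The pullback of `T` and the quotient map is an extension of `Y` by $c_0$. Given a left inverse
`r`, the map `(y, x) ↦ x - r (y, x)` vanishes on the kernel of the projection to `Y`, so it descends
to a lift. -/
theorem exists_lift_of_extEqZero (h : ExtEqZero Y czero) (T : Y →L[ℝ] EllInfty ⧸ czero) :
    ∃ S : Y →L[ℝ] EllInfty, ∀ y : Y, Submodule.Quotient.mk (S y) = T y := by
  have := isClosed_czero
  let D : Y × EllInfty →L[ℝ] EllInfty ⧸ czero :=
    T.comp (ContinuousLinearMap.fst ℝ Y EllInfty) -
      czero.mkQL.comp (ContinuousLinearMap.snd ℝ Y EllInfty)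
  let X : Submodule ℝ (Y × EllInfty) := LinearMap.ker D.toLinearMap
  have hX : ∀ w : Y × EllInfty, w ∈ X ↔ T w.1 = Submodule.Quotient.mk w.2 := fun w => by
    rw [LinearMap.mem_ker]
    exact sub_eq_zero
  have hclosed : IsClosed (X : Set (Y × EllInfty)) := by
    have : IsClosed ({0} : Set (EllInfty ⧸ czero)) := isClosed_singleton
    exact this.preimage D.continuous
  have : CompleteSpace X := hclosed.completeSpace_coe
  let i : czero →L[ℝ] X :=
    ((ContinuousLinearMap.inr ℝ Y EllInfty).comp czero.subtypeL).codRestrict X fun z => by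
      rw [hX]
      change T 0 = Submodule.Quotient.mk (z : EllInfty)
      rw [map_zero, eq_comm, Submodule.Quotient.mk_eq_zero]
      exact z.2
  let p : X →L[ℝ] Y := (ContinuousLinearMap.fst ℝ Y EllInfty).comp X.subtypeL
  have hi : Function.Injective i := fun a b hab =>
    Subtype.ext (congrArg (fun w : X => (w : Y × EllInfty).2) hab)
  have hp : Function.Surjective p := fun y => by
    obtain ⟨x, hx⟩ := Submodule.Quotient.mk_surjective czero (T y)
    exact ⟨⟨(y, x), (hX _).2 hx.symm⟩, rfl⟩
  have hker : ∀ w : X, p w = 0 → ∃ z, i z = w := fun w hw => by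
    have h1 : (w : Y × EllInfty).1 = 0 := hw
    have h2 := (hX w).1 w.2
    rw [h1, map_zero, eq_comm, Submodule.Quotient.mk_eq_zero] at h2
    exact ⟨⟨_, h2⟩, Subtype.ext (Prod.ext h1.symm rfl)⟩
  obtain ⟨r, hr⟩ := h X i p hi (fun w => ⟨hker w, by rintro ⟨z, rfl⟩; rfl⟩) hp
  obtain ⟨S, hS⟩ := p.exists_factor_of_surjective hp
    ((ContinuousLinearMap.snd ℝ Y EllInfty).comp X.subtypeL - czero.subtypeL.comp r)
    fun w hw => by
      obtain ⟨z, rfl⟩ := hker w hw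
      change (z : EllInfty) - (r (i z) : EllInfty) = 0
      rw [hr, sub_self]
  refine ⟨S, fun y => ?_⟩
  obtain ⟨w, rfl⟩ := hp y
  rw [hS]
  change Submodule.Quotient.mk ((w : Y × EllInfty).2 - (r w : EllInfty)) = T (w : Y × EllInfty).1
  rw [Submodule.Quotient.mk_sub, (Submodule.Quotient.mk_eq_zero _).2 (r w).2, sub_zero,
    (hX w).1 w.2]

end Lifting

/-! ### Null sequences and nonprincipal ultrafilters -/

section Ultrafilters

theorem mem_omegaStar_iff {U : BetaOmega} : U ∈ omegaStar ↔ (U : Filter ℕ) ≤ atTop := by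
  rw [← Nat.cofinite_eq_atTop]
  constructor
  · intro h
    rcases U.le_cofinite_or_eq_pure with h' | ⟨n, rfl⟩
    · exact h'
    · exact absurd (mem_range_self n) h
  · rintro h ⟨n, rfl⟩
    have : n ∈ ({n}ᶜ : Set ℕ) := h (finite_singleton n).compl_mem_cofinite
    exact this rfl

theorem isClosed_omegaStar : IsClosed omegaStar := by
  have : omegaStar = ⋂ n : ℕ, {U : Ultrafilter ℕ | {n}ᶜ ∈ U} := by
    ext U
    rw [mem_omegaStar_iff, ← Nat.cofinite_eq_atTop, le_cofinite_iff_compl_singleton_mem, mem_iInter]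
    rfl
  rw [this]
  exact isClosed_iInter fun n => ultrafilter_isClosed_basic _

theorem mem_czero_iff_ultrafilter {x : EllInfty} :
    x ∈ czero ↔ ∀ U ∈ omegaStar, Tendsto (fun n => x n) (U : Filter ℕ) (𝓝 0) := by
  simp_rw [mem_omegaStar_iff]
  exact tendsto_iff_ultrafilter _ _ _

theorem tendsto_of_mk_eq_mk {x x' : EllInfty} {U : BetaOmega} (hU : U ∈ omegaStar) {a : ℝ}
    (h : (Submodule.Quotient.mk x : EllInfty ⧸ czero) = Submodule.Quotient.mk x')
    (hx : Tendsto (fun n => x n) (U : Filter ℕ) (𝓝 a)) :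
    Tendsto (fun n => x' n) (U : Filter ℕ) (𝓝 a) := by
  rw [Submodule.Quotient.eq, mem_czero_iff_ultrafilter] at h
  have := hx.sub (h U hU)
  simpa using this

end Ultrafilters

/-! ### Weak* limits and the functionals induced by an operator -/

section WeakStar

variable {Y : Type u} [NormedAddCommGroup Y] [NormedSpace ℝ Y]

theorem WeakDual.tendsto_iff_forall_apply {ι : Type*} {l : Filter ι} {f : ι → WeakDual ℝ Y}
    {x : WeakDual ℝ Y} :
    Tendsto f l (𝓝 x) ↔ ∀ y, Tendsto (fun i => f i y) l (𝓝 (x y)) :=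
  WeakBilin.tendsto_iff_forall_eval_tendsto (topDualPairing ℝ Y)
    (fun _ _ h => ContinuousLinearMap.ext fun y => LinearMap.congr_fun h y)

/-- Evaluations are bounded on `K`, so the uniform boundedness principle applies. -/
theorem IsCompact.exists_norm_toStrongDual_le [CompleteSpace Y] {K : Set (WeakDual ℝ Y)}
    (hK : IsCompact K) : ∃ M, 0 ≤ M ∧ ∀ f ∈ K, ‖WeakDual.toStrongDual f‖ ≤ M := by
  obtain ⟨M, hM⟩ := banach_steinhaus (g := fun f : K => WeakDual.toStrongDual (f : WeakDual ℝ Y))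
    fun y => by
      obtain ⟨C, hC⟩ := hK.exists_bound_of_continuousOn (WeakDual.eval_continuous y).continuousOn
      exact ⟨C, fun f => hC f f.2⟩
  exact ⟨max M 0, le_max_right _ _, fun f hf => (hM ⟨f, hf⟩).trans (le_max_left _ _)⟩

/-- A bounded sequence of functionals extends weak* continuously to `BetaOmega`. -/
theorem exists_continuous_extension_betaOmega {s : ℕ → StrongDual ℝ Y} {C : ℝ}
    (hs : ∀ n, ‖s n‖ ≤ C) :
    ∃ g : BetaOmega → WeakDual ℝ Y, Continuous g ∧
      ∀ (U : BetaOmega) y, Tendsto (fun n => s n y) (U : Filter ℕ) (𝓝 (g U y)) := by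
  have hK := WeakDual.isCompact_closedBall (𝕜 := ℝ) (0 : StrongDual ℝ Y) C
  have := isCompact_iff_compactSpace.1 hK
  let σ : ℕ → (WeakDual.toStrongDual ⁻¹' Metric.closedBall (0 : StrongDual ℝ Y) C) := fun n =>
    ⟨StrongDual.toWeakDual (s n), by simpa using hs n⟩
  have hcont : Continuous (Subtype.val ∘ Ultrafilter.extend σ : BetaOmega → WeakDual ℝ Y) :=
    continuous_subtype_val.comp (continuous_ultrafilter_extend σ)
  refine ⟨_, hcont, fun U y => ?_⟩
  have := ((WeakDual.eval_continuous y).comp hcont).tendsto U |>.comp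
    (Ultrafilter.tendsto_pure_self U)
  refine this.congr fun n => ?_
  simp only [Function.comp_apply, ultrafilter_extend_pure]
  rfl

/-- Limits along nonprincipal ultrafilters of representatives of an operator into
`EllInfty ⧸ czero`. -/
theorem exists_limit_functional {T : Y →L[ℝ] EllInfty ⧸ czero} {C : ℝ} (hT : ‖T‖ ≤ C)
    {x : Y → EllInfty} (hx : ∀ y, Submodule.Quotient.mk (x y) = T y) {U : BetaOmega}
    (hU : U ∈ omegaStar) :
    ∃ φ : StrongDual ℝ Y, ‖φ‖ ≤ C ∧ ∀ y, Tendsto (fun n => x y n) (U : Filter ℕ) (𝓝 (φ y)) := by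
  -- The limit along `U` is a functional `ℓ` of norm at most one on $\ell_\infty$ that kills $c_0$.
  -- It descends to `Λ` on the quotient, and `Λ ∘ T` is the required functional.
  obtain ⟨s, hs, hsx⟩ := exists_coordinate_functionals (ContinuousLinearMap.id ℝ EllInfty)
  obtain ⟨ℓ, hℓ, hlim⟩ := exists_pointwise_limit_ultrafilter U
    (fun n => (hs n).trans ContinuousLinearMap.norm_id_le)
  have hlim' : ∀ z : EllInfty, Tendsto (fun n => z n) (U : Filter ℕ) (𝓝 (ℓ z)) := fun z =>
    (hlim z).congr fun n => hsx z n
  have hker : ∀ z ∈ czero, ℓ z = 0 := fun z hz =>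
    tendsto_nhds_unique (hlim' z) (mem_czero_iff_ultrafilter.1 hz U hU)
  let Λ : EllInfty ⧸ czero →ₗ[ℝ] ℝ := czero.liftQ ℓ.toLinearMap hker
  have hΛ : ∀ q, ‖Λ q‖ ≤ ‖q‖ := fun q => by
    refine le_of_forall_pos_le_add fun ε hε => ?_
    obtain ⟨z, rfl, hz⟩ := Submodule.Quotient.norm_mk_lt q hε
    exact ((ℓ.le_of_opNorm_le hℓ z).trans (one_mul _).le).trans hz.le
  have hC : 0 ≤ C := (norm_nonneg T).trans hT
  refine ⟨(Λ ∘ₗ T.toLinearMap).mkContinuous C fun y => (hΛ _).trans (T.le_of_opNorm_le hT y),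
    LinearMap.mkContinuous_norm_le _ hC _, fun y => ?_⟩
  have : Λ (T y) = ℓ (x y) := by rw [← hx]; rfl
  change Tendsto _ _ (𝓝 (Λ (T y)))
  rw [this]
  exact hlim' _

end WeakStar

/-! ### From lifting operators to extending maps on $\omega^*$ -/

section Extension

variable {Y : Type u} [NormedAddCommGroup Y] [NormedSpace ℝ Y] [CompleteSpace Y]

theorem exists_extension_of_forall_lift
    (h : ∀ T : Y →L[ℝ] EllInfty ⧸ czero,
      ∃ S : Y →L[ℝ] EllInfty, ∀ y : Y, Submodule.Quotient.mk (S y) = T y)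
    (f : omegaStar → WeakDual ℝ Y) (hf : Continuous f) :
    ∃ g : BetaOmega → WeakDual ℝ Y, Continuous g ∧ ∀ x : omegaStar, g x = f x := by
  have : CompactSpace omegaStar := isCompact_iff_compactSpace.1 isClosed_omegaStar.isCompact
  obtain ⟨M, hM, hfM⟩ := (isCompact_range hf).exists_norm_toStrongDual_le
  have hext : ∀ y, ∃ x : EllInfty, ‖x‖ ≤ M * ‖y‖ ∧
      ∀ U : omegaStar, Tendsto (fun n => x n) (U : Ultrafilter ℕ) (𝓝 (f U y)) := by
    intro y
    let F : BoundedContinuousFunction omegaStar ℝ :=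
      BoundedContinuousFunction.mkOfCompact ⟨fun U => f U y, (WeakDual.eval_continuous y).comp hf⟩
    have hF : ‖F‖ ≤ M * ‖y‖ := (BoundedContinuousFunction.norm_le (by positivity)).2 fun U =>
      (WeakDual.toStrongDual (f U)).le_of_opNorm_le (hfM _ (mem_range_self U)) y
    -- Tietze's theorem with preservation of the norm, which later bounds the operator by `M`.
    obtain ⟨G, hG, hGF⟩ := BoundedContinuousFunction.exists_extension_norm_eq_of_isClosedEmbedding F
      isClosed_omegaStar.isClosedEmbedding_subtypeVal
    have hb : ∀ n : ℕ, ‖G (pure n)‖ ≤ M * ‖y‖ := fun n =>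
      (G.norm_coe_le_norm _).trans (hG.trans_le hF)
    refine ⟨⟨fun n => G (pure n), memℓp_infty ⟨M * ‖y‖, by rintro _ ⟨n, rfl⟩; exact hb n⟩⟩,
      lp.norm_le_of_forall_le (by positivity) hb, fun U => ?_⟩
    have h1 : G U = f U y := congrFun hGF U
    rw [← h1]
    exact (G.continuous.tendsto (U : BetaOmega)).comp (Ultrafilter.tendsto_pure_self _)
  choose x hx hlim using hext
  -- The choice of `x y` need not be linear in `y`, but its limits on $\omega^*$ are, and they
  -- determine the class modulo $c_0$.
  let T : Y →ₗ[ℝ] EllInfty ⧸ czero :=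
    { toFun := fun y => Submodule.Quotient.mk (x y)
      map_add' := fun y z => by
        rw [← Submodule.Quotient.mk_add, Submodule.Quotient.eq, mem_czero_iff_ultrafilter]
        intro U hU
        have := (hlim (y + z) ⟨U, hU⟩).sub ((hlim y ⟨U, hU⟩).add (hlim z ⟨U, hU⟩))
        simpa using this
      map_smul' := fun c y => by
        rw [RingHom.id_apply, ← Submodule.Quotient.mk_smul, Submodule.Quotient.eq,
          mem_czero_iff_ultrafilter]
        intro U hU
        have := (hlim (c • y) ⟨U, hU⟩).sub ((hlim y ⟨U, hU⟩).const_mul c)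
        rw [map_smul, smul_eq_mul, sub_self] at this
        exact this }
  obtain ⟨S, hS⟩ := h (T.mkContinuous M fun y => (Submodule.Quotient.norm_mk_le _ _).trans (hx y))
  obtain ⟨s, hs, hsS⟩ := exists_coordinate_functionals S
  obtain ⟨g, hg, hgs⟩ := exists_continuous_extension_betaOmega hs
  refine ⟨g, hg, fun U => ?_⟩
  refine DFunLike.ext _ _ fun y => ?_
  refine tendsto_nhds_unique ((hgs U y).congr fun n => hsS y n) ?_
  exact tendsto_of_mk_eq_mk U.2 (hS y).symm (hlim y U)

end Extension

/-! ### From realizing extensions of the dual ball to lifting -/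

section RealizableToLift

variable {Y : Type u} [NormedAddCommGroup Y] [NormedSpace ℝ Y]

/-- The points `y ↦ x y n` of $\mathbb R^Y$ need not be linear, but their limits along nonprincipal
ultrafilters are functionals in the dual ball. The extra coordinate `1 / (n + 1)` separates them
from the ball and from each other. -/
theorem exists_isCountableDiscreteExtension_dualBall {T : Y →L[ℝ] EllInfty ⧸ czero}
    (hT : ‖T‖ ≤ 1) {x : Y → EllInfty} (hx : ∀ y, Submodule.Quotient.mk (x y) = T y) :
    ∃ (L : Type u) (_ : TopologicalSpace L) (j : dualBall Y → L) (p : ℕ → L),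
      IsCountableDiscreteExtension j ∧ ∀ U ∈ omegaStar, ∃ φ : dualBall Y,
        Tendsto p (U : Filter ℕ) (𝓝 (j φ)) ∧
          ∀ y, Tendsto (fun n => x y n) (U : Filter ℕ) (𝓝 ((φ : WeakDual ℝ Y) y)) := by
  have hball : IsCompact (dualBall Y) := WeakDual.isCompact_closedBall 0 1
  have : CompactSpace (dualBall Y) := isCompact_iff_compactSpace.1 hball
  let ι : WeakDual ℝ Y → (Y → ℝ) × ℝ := fun a => (fun y => a y, 0)
  have hι : Continuous ι := (WeakDual.coeFn_continuous).prodMk continuous_const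
  let P : ℕ → (Y → ℝ) × ℝ := fun n => (fun y => x y n, 1 / ((n : ℝ) + 1))
  let A : Set ((Y → ℝ) × ℝ) := ι '' dualBall Y ∪ range P
  have hlim : ∀ U ∈ omegaStar, ∃ φ ∈ dualBall Y, Tendsto P (U : Filter ℕ) (𝓝 (ι φ)) ∧
      ∀ y, Tendsto (fun n => x y n) (U : Filter ℕ) (𝓝 (φ y)) := fun U hU => by
    obtain ⟨φ, hφ, hlim⟩ := exists_limit_functional hT hx hU
    exact ⟨StrongDual.toWeakDual φ, by simpa [dualBall] using hφ,
      (tendsto_pi_nhds.2 hlim).prodMk_nhds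
        (tendsto_one_div_add_atTop_nhds_zero_nat.mono_left (mem_omegaStar_iff.1 hU)), hlim⟩
  have hP2 : ∀ n, (P n).2 ≠ 0 := fun n => by positivity
  have hPinj : Function.Injective P := fun m n hmn => by
    have : 1 / ((m : ℝ) + 1) = 1 / ((n : ℝ) + 1) := congrArg Prod.snd hmn
    rw [one_div, one_div, inv_inj, add_left_inj] at this
    exact_mod_cast this
  have hA : IsCompact A := by
    rw [isCompact_iff_ultrafilter_le_nhds]
    intro W hW
    rcases Ultrafilter.union_mem_iff.1 (le_principal_iff.1 hW) with h1 | h2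
    · obtain ⟨z, hz, hWz⟩ :=
        isCompact_iff_ultrafilter_le_nhds.1 (hball.image hι) W (le_principal_iff.2 h1)
      exact ⟨z, Or.inl hz, hWz⟩
    · have hmap : map P (W.comap hPinj h2) = W := by
        rw [Ultrafilter.coe_comap, map_comap_of_mem h2]
      by_cases hU : W.comap hPinj h2 ∈ omegaStar
      · obtain ⟨φ, hφ, hPφ, -⟩ := hlim _ hU
        refine ⟨ι φ, Or.inl (mem_image_of_mem _ hφ), ?_⟩
        rw [← hmap]
        exact hPφ
      · obtain ⟨n, hn⟩ := notMem_compl_iff.1 hU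
        refine ⟨P n, Or.inr (mem_range_self n), ?_⟩
        rw [← hmap, ← hn]
        exact pure_le_nhds _
  have : CompactSpace A := isCompact_iff_compactSpace.1 hA
  let j : dualBall Y → A := fun a => ⟨ι a, Or.inl (mem_image_of_mem _ a.2)⟩
  let p : ℕ → A := fun n => ⟨P n, Or.inr (mem_range_self n)⟩
  have hj : Continuous j := (hι.comp continuous_subtype_val).subtype_mk _
  have hjinj : Function.Injective j := fun a b hab => Subtype.ext <| DFunLike.ext _ _ fun y =>
    congrFun (congrArg (fun z : A => z.1.1) hab) y
  have hcompl : (range j)ᶜ = range p := by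
    ext z
    constructor
    · intro hz
      rcases z.2 with ⟨a, ha, haz⟩ | ⟨n, hn⟩
      · exact absurd ⟨⟨a, ha⟩, Subtype.ext haz⟩ hz
      · exact ⟨n, Subtype.ext hn⟩
    · rintro ⟨n, rfl⟩ ⟨a, ha⟩
      exact hP2 n (congrArg (fun z : A => z.1.2) ha).symm
  have hpinj : Function.Injective p := fun m n hmn => hPinj (congrArg Subtype.val hmn)
  refine ⟨A, inferInstance, j, p, ⟨inferInstance, inferInstance, (hj.isClosedEmbedding hjinj).isEmbedding,
    hcompl ▸ countable_range p, hcompl ▸ infinite_range_of_injective hpinj, ?_⟩, fun U hU => ?_⟩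
  · rw [hcompl, discreteTopology_iff_isOpen_singleton]
    rintro ⟨_, n, rfl⟩
    -- The inverse of the last coordinate takes the value `m + 1` at `p m`, so a ball of radius 1
    -- isolates each point.
    have hcont : Continuous fun z : range p => (z : A).1.2⁻¹ := by
      refine Continuous.inv₀ (by fun_prop) ?_
      rintro ⟨_, m, rfl⟩
      exact hP2 m
    have hval : ∀ m, (p m).1.2⁻¹ = (m : ℝ) + 1 := fun m => by simp [p, P]
    have hiff : ∀ m, p m = p n ↔ (p m).1.2⁻¹ ∈ Metric.ball ((n : ℝ) + 1) 1 := fun m => by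
      have hint : |(m : ℝ) - n| < 1 ↔ |(m : ℤ) - n| < 1 := by exact_mod_cast Iff.rfl
      rw [hpinj.eq_iff, Metric.mem_ball, hval, dist_add_right, Real.dist_eq, hint,
        Int.abs_lt_one_iff]
      omega
    convert Metric.isOpen_ball (x := (n : ℝ) + 1) (ε := 1) |>.preimage hcont
    refine Set.ext fun z => ?_
    obtain ⟨z, m, rfl⟩ := z
    exact Subtype.ext_iff.trans (hiff m)
  · obtain ⟨φ, hφ, hPφ, hy⟩ := hlim U hU
    exact ⟨⟨φ, hφ⟩, tendsto_subtype_rng.2 hPφ, hy⟩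

/-- After rescaling `T`, the realized isolated points are a bounded sequence of functionals. Its
limits along $\omega^*$ agree with those of `x y`, so it lifts `T`. -/
theorem exists_lift_of_realizable [CompleteSpace Y]
    (h : DiscreteExtensionsRealizable (dualBall Y))
    (T : Y →L[ℝ] EllInfty ⧸ czero) :
    ∃ S : Y →L[ℝ] EllInfty, ∀ y : Y, Submodule.Quotient.mk (S y) = T y := by
  suffices H : ∀ T : Y →L[ℝ] EllInfty ⧸ czero, ‖T‖ ≤ 1 →
      ∃ S : Y →L[ℝ] EllInfty, ∀ y : Y, Submodule.Quotient.mk (S y) = T y by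
    have hc : 0 < ‖T‖ + 1 := by positivity
    obtain ⟨S, hS⟩ := H (T.comp ((‖T‖ + 1)⁻¹ • ContinuousLinearMap.id ℝ Y)) <|
      ContinuousLinearMap.opNorm_le_bound _ zero_le_one fun y => by
        refine (T.le_opNorm ((‖T‖ + 1)⁻¹ • y)).trans ?_
        rw [norm_smul, norm_inv, Real.norm_of_nonneg hc.le, ← mul_assoc]
        gcongr
        rw [← div_eq_mul_inv, div_le_one hc]
        linarith
    refine ⟨S.comp ((‖T‖ + 1) • ContinuousLinearMap.id ℝ Y), fun y => (hS _).trans ?_⟩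
    change T ((‖T‖ + 1)⁻¹ • (‖T‖ + 1) • y) = T y
    rw [inv_smul_smul₀ hc.ne']
  clear T
  intro T hT
  choose x hx using fun y => Submodule.Quotient.mk_surjective czero (T y)
  obtain ⟨L, _, j, p, hj, hlim⟩ := exists_isCountableDiscreteExtension_dualBall hT hx
  obtain ⟨φ, hφ, hφj⟩ := h L j hj
  have := hj.compactSpace
  obtain ⟨M, hM, hbound⟩ := (isCompact_range hφ.continuous).exists_norm_toStrongDual_le
  obtain ⟨S, hS⟩ := exists_clm_ellInfty (g := fun n => WeakDual.toStrongDual (φ (p n)))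
    fun n => hbound _ (mem_range_self _)
  refine ⟨S, fun y => ?_⟩
  rw [← hx y, Submodule.Quotient.eq, mem_czero_iff_ultrafilter]
  intro U hU
  obtain ⟨ψ, hpψ, hy⟩ := hlim U hU
  have h1 := ((WeakDual.eval_continuous y).tendsto _).comp ((hφ.continuous.tendsto _).comp hpψ)
  rw [hφj] at h1
  have h2 := h1.sub (hy y)
  rw [sub_self] at h2
  refine h2.congr fun n => ?_
  rw [show (S y - x y) n = S y n - x y n from rfl, hS]
  rfl

end RealizableToLift

/-! ### From extending maps on $\omega^*$ to realizing discrete extensions -/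

section ExtensionToRealizable

variable {Y : Type u} [NormedAddCommGroup Y] [NormedSpace ℝ Y]

/-- A generic weak* small perturbation of a sequence is injective. -/
theorem exists_injective_perturbation {E : Type*} [NormedAddCommGroup E] [NormedSpace ℝ E]
    (s x : ℕ → E) (hx : ∀ n, ‖x n‖ = 1) {c : ℝ} (hc : 0 < c) :
    ∃ t ∈ Icc (0 : ℝ) 1,
      Function.Injective fun n : ℕ => s n + (c * (1 + t * ((n : ℝ) + 1)⁻¹)) • x n := by
  let bad : ℕ × ℕ → Set ℝ := fun k => {t | k.1 ≠ k.2 ∧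
    s k.1 + (c * (1 + t * ((k.1 : ℝ) + 1)⁻¹)) • x k.1 =
      s k.2 + (c * (1 + t * ((k.2 : ℝ) + 1)⁻¹)) • x k.2}
  -- Two bad parameters for one pair would, after subtraction, equate vectors of norms `1 / (n + 1)`
  -- and `1 / (m + 1)`. So each pair excludes at most one `t`, and `[0, 1]` is uncountable.
  have hbad : ∀ k, (bad k).Subsingleton := by
    rintro ⟨n, m⟩ t ⟨hne, ht⟩ t' ⟨-, ht'⟩
    by_contra htt
    have hdiff : (c * (t - t')) • (((n : ℝ) + 1)⁻¹ • x n) =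
        (c * (t - t')) • (((m : ℝ) + 1)⁻¹ • x m) := by
      have h1 := congrArg₂ (· - ·) ht ht'
      simp only [add_sub_add_left_eq_sub, ← sub_smul] at h1
      rw [smul_smul, smul_smul]
      convert! h1 using 2 <;> ring
    have h2 := smul_right_injective E (mul_ne_zero hc.ne' (sub_ne_zero.2 htt)) hdiff
    have h3 := congrArg norm h2
    rw [norm_smul, norm_smul, hx, hx, mul_one, mul_one, Real.norm_of_nonneg (by positivity),
      Real.norm_of_nonneg (by positivity), inv_inj, add_left_inj, Nat.cast_inj] at h3
    exact hne h3
  have hcount : (⋃ k, bad k).Countable := countable_iUnion fun k => (hbad k).countable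
  have hnot : ¬ Icc (0 : ℝ) 1 ⊆ ⋃ k, bad k := fun hsub => by
    have := Cardinal.Real.Icc_countable_iff.1 (hcount.mono hsub)
    exact absurd this (by norm_num)
  obtain ⟨t, ht, htbad⟩ := not_subset.1 hnot
  refine ⟨t, ht, fun n m hnm => ?_⟩
  by_contra hne
  exact htbad (mem_iUnion.2 ⟨(n, m), hne, hnm⟩)

/-- The points of the complement of a countable discrete extension form a sequence of isolated
points. -/
theorem IsCountableDiscreteExtension.exists_enumeration {K : Type u} {L : Type v}
    [TopologicalSpace K] [TopologicalSpace L] [CompactSpace K] {j : K → L}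
    (hj : IsCountableDiscreteExtension j) :
    ∃ p : ℕ → L, Function.Injective p ∧ range p = (range j)ᶜ ∧ ∀ n, IsOpen {p n} := by
  have := hj.t2Space
  have := hj.discrete_compl
  have := hj.infinite_compl.to_subtype
  have := hj.countable_compl.to_subtype
  obtain ⟨_⟩ := nonempty_denumerable ↥(range j)ᶜ
  let e : ↥(range j)ᶜ ≃ ℕ := Denumerable.eqv _
  refine ⟨fun n => e.symm n, Subtype.val_injective.comp e.symm.injective, ?_, fun n => ?_⟩
  · change range (Subtype.val ∘ e.symm) = _
    rw [e.symm.surjective.range_comp, Subtype.range_val]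
  · have hopen : IsOpen (range j)ᶜ :=
      (isCompact_range hj.isEmbedding.continuous).isClosed.isOpen_compl
    have := hopen.isOpenMap_subtype_val {e.symm n} (isOpen_discrete _)
    rwa [image_singleton] at this

/-- A map on a countable discrete extension is continuous if it is continuous on the base and has
the right limits along nonprincipal ultrafilters on the complement. -/
theorem IsCountableDiscreteExtension.continuous_of_ultrafilter {K : Type u} {L : Type v} {Z : Type*}
    [TopologicalSpace K] [TopologicalSpace L] [TopologicalSpace Z] {j : K → L}
    (hj : IsCountableDiscreteExtension j) {p : ℕ → L} (hp : Function.Injective p)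
    (hrange : range p = (range j)ᶜ) (hopen : ∀ n, IsOpen {p n}) {φ : L → Z}
    (hφj : Continuous (φ ∘ j))
    (hφp : ∀ U ∈ omegaStar, ∀ a, Tendsto p (U : Filter ℕ) (𝓝 (j a)) →
      Tendsto (φ ∘ p) (U : Filter ℕ) (𝓝 (φ (j a)))) : Continuous φ := by
  have := hj.t2Space
  rw [continuous_iff_continuousAt]
  intro z
  by_cases hz : z ∈ range j
  · obtain ⟨a, rfl⟩ := hz
    rw [ContinuousAt, ← nhdsWithin_univ, ← union_compl_self (range j), nhdsWithin_union,
      tendsto_sup, ← hj.isEmbedding.map_nhds_eq, tendsto_map'_iff]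
    refine ⟨hφj.tendsto a, ?_⟩
    rw [tendsto_iff_ultrafilter]
    intro W hW
    have hmem : range p ∈ W := by
      rw [hrange]
      exact hW self_mem_nhdsWithin
    have hmap : map p (W.comap hp hmem) = W := by
      rw [Ultrafilter.coe_comap, map_comap_of_mem hmem]
    have hWa : Tendsto p (W.comap hp hmem) (𝓝 (j a)) := by
      rw [Tendsto, hmap]
      exact hW.trans nhdsWithin_le_nhds
    rw [← hmap, tendsto_map'_iff]
    refine hφp _ ?_ a hWa
    -- A principal ultrafilter at `n` would make `p` converge to `p n`, which differs from `j a`.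
    rintro ⟨n, hn⟩
    rw [← hn] at hWa
    have hne : j a ≠ p n := fun h => by
      have : p n ∈ (range j)ᶜ := hrange ▸ mem_range_self n
      exact this ⟨a, h⟩
    have h1 : {p n}ᶜ ∈ map p (pure n : Filter ℕ) := hWa (isOpen_compl_singleton.mem_nhds hne)
    rw [map_pure] at h1
    exact h1 rfl
  · rw [← mem_compl_iff, ← hrange] at hz
    obtain ⟨n, rfl⟩ := hz
    rw [ContinuousAt, isOpen_singleton_iff_nhds_eq_pure _ |>.1 (hopen n)]
    exact tendsto_pure_nhds φ (p n)

theorem realizable_of_forall_extension [CompleteSpace Y] (hY : ¬ FiniteDimensional ℝ Y)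
    (h : ∀ f : omegaStar → WeakDual ℝ Y, Continuous f →
      ∃ g : BetaOmega → WeakDual ℝ Y, Continuous g ∧ ∀ x : omegaStar, g x = f x)
    {K : Set (WeakDual ℝ Y)} (hK : IsCompact K) : DiscreteExtensionsRealizable K := by
  classical
  intro L _ j hj
  have := hj.compactSpace
  have := hj.t2Space
  have := isCompact_iff_compactSpace.1 hK
  obtain ⟨p, hp, hrange, hopen⟩ := hj.exists_enumeration
  have hpj : ∀ n a, j a ≠ p n := fun n a h => by
    have : p n ∈ (range j)ᶜ := hrange ▸ mem_range_self n
    exact this ⟨a, h⟩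
  -- An isolated point `p n` cannot be a limit of the injective sequence `p` along a nonprincipal
  -- ultrafilter, so the limits lie in the copy of `K`.
  have hlim : ∀ U : omegaStar, ∃ a, j a = Ultrafilter.extend p U := by
    rintro ⟨U, hU⟩
    by_contra hnot
    have h1 : Ultrafilter.extend p U ∈ range p := by
      rw [hrange]
      exact hnot
    obtain ⟨n, hn⟩ := h1
    have h2 : Tendsto p (U : Filter ℕ) (𝓝 (p n)) := ultrafilter_extend_eq_iff.1 hn.symm
    have h3 : ∀ᶠ k in (U : Filter ℕ), k = n := by
      filter_upwards [h2 ((hopen n).mem_nhds rfl)] with k hk using hp hk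
    obtain ⟨k, hk1, hk2⟩ :=
      (h3.and ((eventually_gt_atTop n).filter_mono (mem_omegaStar_iff.1 hU))).exists
    exact hk2.ne' hk1
  choose f hf using hlim
  have hfcont : Continuous f := by
    rw [hj.isEmbedding.continuous_iff]
    rw [show j ∘ f = fun U : omegaStar => Ultrafilter.extend p (U : BetaOmega) from funext hf]
    exact (continuous_ultrafilter_extend p).comp continuous_subtype_val
  obtain ⟨g, hg, hgf⟩ := h _ (continuous_subtype_val.comp hfcont)
  obtain ⟨M₁, hM₁, hKM⟩ := hK.exists_norm_toStrongDual_le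
  obtain ⟨M₂, hM₂, hgM⟩ := (isCompact_range hg).exists_norm_toStrongDual_le
  obtain ⟨x, hx1, hx0⟩ := exists_norm_eq_one_tendsto_zero hY
  -- Since `K` has norm bound `M₁` and `g` has norm bound `M₂`, a perturbation of norm at least `M₁
  -- + M₂ + 1` pushes every new functional out of `K`. It is still weak* null because the factors `r
  -- n` converge.
  set c : ℝ := M₁ + M₂ + 1 with hc
  have hc0 : 0 < c := by positivity
  obtain ⟨t, ht, hinj⟩ := exists_injective_perturbation
    (fun n => WeakDual.toStrongDual (g (pure n))) x hx1 hc0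
  set r : ℕ → ℝ := fun n => c * (1 + t * ((n : ℝ) + 1)⁻¹) with hr
  have hrc : ∀ n, c ≤ r n := fun n => by
    have : 0 ≤ t * ((n : ℝ) + 1)⁻¹ := mul_nonneg ht.1 (by positivity)
    nlinarith
  set s : ℕ → StrongDual ℝ Y := fun n => WeakDual.toStrongDual (g (pure n)) + r n • x n with hs
  have hsnorm : ∀ n, M₁ < ‖s n‖ := fun n => by
    have h1 : ‖r n • x n‖ = r n := by
      rw [norm_smul, hx1, mul_one, Real.norm_of_nonneg (hc0.le.trans (hrc n))]
    have h2 : ‖r n • x n‖ ≤ ‖s n‖ + ‖WeakDual.toStrongDual (g (pure n))‖ := by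
      have := norm_sub_le (s n) (WeakDual.toStrongDual (g (pure n)))
      rwa [hs, add_sub_cancel_left] at this
    linarith [hrc n, hgM _ (mem_range_self (pure n))]
  have hnull : ∀ y, Tendsto (fun n => r n * x n y) atTop (𝓝 0) := fun y => by
    have h1 : Tendsto r atTop (𝓝 (c * (1 + t * 0))) := by
      refine (((tendsto_const_nhds (x := t)).mul ?_).const_add 1).const_mul c
      simpa [one_div] using tendsto_one_div_add_atTop_nhds_zero_nat (𝕜 := ℝ)
    simpa using h1.mul (hx0 y)
  let φ : L → WeakDual ℝ Y := fun z =>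
    if hz : ∃ a, j a = z then (hz.choose : WeakDual ℝ Y)
    else StrongDual.toWeakDual (s (Function.invFun p z))
  have hφj : ∀ a, φ (j a) = a := fun a => by
    have hex : ∃ b, j b = j a := ⟨a, rfl⟩
    simp only [φ, dif_pos hex]
    rw [hj.isEmbedding.injective hex.choose_spec]
  have hφp : ∀ n, φ (p n) = StrongDual.toWeakDual (s n) := fun n => by
    have hex : ¬ ∃ b, j b = p n := fun ⟨b, hb⟩ => hpj n b hb
    simp only [φ, dif_neg hex]
    rw [Function.leftInverse_invFun hp n]
  have hcases : ∀ z, z ∈ range j ∨ z ∈ range p := fun z => by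
    rw [hrange]
    exact em _
  have hnotK : ∀ n (a : K), StrongDual.toWeakDual (s n) ≠ a := fun n a hna => by
    have h1 := hKM a a.2
    rw [← hna] at h1
    exact (hsnorm n).not_ge h1
  have hφinj : Function.Injective φ := by
    intro z w hzw
    rcases hcases z with ⟨a, rfl⟩ | ⟨n, rfl⟩ <;> rcases hcases w with ⟨b, rfl⟩ | ⟨m, rfl⟩
    · rw [hφj, hφj] at hzw
      rw [Subtype.ext hzw]
    · rw [hφj, hφp] at hzw
      exact absurd hzw.symm (hnotK m a)
    · rw [hφj, hφp] at hzw
      exact absurd hzw (hnotK n b)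
    · rw [hφp, hφp] at hzw
      rw [hinj (StrongDual.toWeakDual.injective hzw)]
  have hφcont : Continuous φ := by
    refine hj.continuous_of_ultrafilter hp hrange hopen ?_ fun U hU a hUa => ?_
    · rw [show φ ∘ j = Subtype.val from funext hφj]
      exact continuous_subtype_val
    · rw [hφj, WeakDual.tendsto_iff_forall_apply]
      intro y
      have hfa : f ⟨U, hU⟩ = a := hj.isEmbedding.injective
        ((hf ⟨U, hU⟩).trans (ultrafilter_extend_eq_iff.2 hUa))
      have hgU : g U = a := (hgf ⟨U, hU⟩).trans (congrArg Subtype.val hfa)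
      have h1 : Tendsto (fun n => g (pure n) y) (U : Filter ℕ) (𝓝 (g U y)) :=
        (((WeakDual.eval_continuous y).comp hg).tendsto U).comp (Ultrafilter.tendsto_pure_self U)
      have h2 := h1.add ((hnull y).mono_left (mem_omegaStar_iff.1 hU))
      rw [hgU, add_zero] at h2
      refine h2.congr fun n => ?_
      rw [Function.comp_apply, hφp]
      rfl
  exact ⟨φ, (hφcont.isClosedEmbedding hφinj).isEmbedding, hφj⟩

end ExtensionToRealizable

theorem theorem3p1 (Y : Type u) [NormedAddCommGroup Y] [NormedSpace ℝ Y] [CompleteSpace Y]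
    (hY : ¬ FiniteDimensional ℝ Y) :
    List.TFAE
      [ExtEqZero Y czero,
       DiscreteExtensionsRealizable (dualBall Y),
       ∀ K : Set (WeakDual ℝ Y), IsCompact K → DiscreteExtensionsRealizable K,
       ∀ f : omegaStar → WeakDual ℝ Y, Continuous f →
         ∃ g : BetaOmega → WeakDual ℝ Y, Continuous g ∧ ∀ x : omegaStar, g x = f x,
       ∀ T : Y →L[ℝ] EllInfty ⧸ czero,
         ∃ S : Y →L[ℝ] EllInfty, ∀ y : Y, Submodule.Quotient.mk (S y) = T y] := by
  tfae_have 1 → 5 := exists_lift_of_extEqZero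
  tfae_have 5 → 1 := extEqZero_of_forall_lift
  tfae_have 5 → 4 := exists_extension_of_forall_lift
  tfae_have 4 → 3 := fun h K hK => realizable_of_forall_extension hY h hK
  tfae_have 3 → 2 := fun h => h _ (WeakDual.isCompact_closedBall 0 1)
  tfae_have 2 → 5 := exists_lift_of_realizable
  tfae_finish
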